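/- Let $0<\alpha<1$ and $0<q<1$ be real constants and let $p$ be a prime. For each $n\in\mathbb{N}$ let $G=G(n,\alpha,q)$ be the random bipartite graph with vertex classes $L$ and $R$, where $|L|=n$ and $|R|=\lfloor\alpha n\rfloor$, in which each pair $(v,u)\in L\times R$ is joined by an edge independently with probability $q$. For a connected finite graph $H$ with Laplacian $\Delta=D-A$ (degree matrix minus adjacency matrix), let $\Delta'$ be the matrix obtained from $\Delta$ by deleting the row and the column of one vertex, chosen arbitrarily; the sandpile group $\Gamma(H)$ is the cokernel $\mathbb{Z}^{|V(H)|-1}/\Delta'\,\mathbb{Z}^{|V(H)|-1}$ (up to isomorphism, it does not depend on the vertex). For a disconnected finite graph, $\Gamma$ is the direct sum of the sandpile groups of the connected components. The $p$-rank of an abelian group $\Gamma$ is $\dim_{\mathbb{Z}/p\mathbb{Z}}(\Gamma/p\Gamma)$. Then, as $n\to\infty$ with $\alpha,q,p$ fixed, the expected value of the $p$-rank of $\Gamma(G(n,\alpha,q))$ is 1. $\left(\frac1p-\alpha\right)n+O(1)$ if $\alpha<\frac1p$; 2. $O(1)$ if $\alpha>\frac1p$; 3. $\sqrt{\dfrac{\frac1p\left(1-\frac1p\right)n}{2\pi}}+O(1)$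 if $\alpha=\frac1p$. The implied constants may depend on $\alpha$, $q$ and $p$. -/

import Mathlib

open MeasureTheory ProbabilityTheory Filter Asymptotics

noncomputable section

/-- The reduced Laplacian of a graph at a vertex `v`: the integer Laplacian `D - A` with the row and
the column of `v` removed. -/
def SimpleGraph.reducedLaplacian {V : Type*} [Fintype V] (G : SimpleGraph V) (v : V) :
    Matrix {w : V // w ≠ v} {w : V // w ≠ v} ℤ :=
  open Classical in (G.lapMatrix ℤ).submatrix Subtype.val Subtype.val

open Classical in
/-- The cokernel of the reduced Laplacian at `v`. For a connected graph this is its sandpile group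
(up to isomorphism, it does not depend on `v`). -/
abbrev SimpleGraph.ReducedLaplacianCoker {V : Type*} [Fintype V] (G : SimpleGraph V) (v : V) :
    Type _ :=
  ({w : V // w ≠ v} → ℤ) ⧸ LinearMap.range (G.reducedLaplacian v).mulVecLin

/-- A choice of a vertex in a connected component. -/
def SimpleGraph.ConnectedComponent.root {V : Type*} {G : SimpleGraph V}
    (C : G.ConnectedComponent) : C :=
  Classical.choice C.connected_toSimpleGraph.nonempty

open Classical in
/-- The sandpile group of a finite graph: the direct sum, over the connected components, of their
sandpile groups. There are finitely many components, so the direct sum is the product. -/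
abbrev SimpleGraph.SandpileGroup {V : Type*} [Fintype V] (G : SimpleGraph V) : Type _ :=
  ∀ C : G.ConnectedComponent, C.toSimpleGraph.ReducedLaplacianCoker C.root

/-- The `p`-rank of an abelian group `A`: the dimension of `A / pA` over `ℤ / pℤ`. -/
def pRank (p : ℕ) (A : Type*) [AddCommGroup A] : ℕ :=
  Module.finrank (ZMod p) (ModN A p)

/-- The bipartite graph with sides `L` and `R` in which `l` and `r` are joined iff
`e (l, r) = true`. -/
def bipartiteGraph {L R : Type*} (e : L × R → Bool) : SimpleGraph (L ⊕ R) :=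
  SimpleGraph.fromRel fun v w => ∃ l r, v = Sum.inl l ∧ w = Sum.inr r ∧ e (l, r) = true

/-- The law of the random bipartite graph whose sides are `Fin n` and `Fin ⌊α n⌋`, where each pair
of a left and a right vertex is joined independently with probability `q`. -/
def randomBipartiteGraph (n : ℕ) (α : ℝ) (q : unitInterval) :
    Measure (SimpleGraph (Fin n ⊕ Fin ⌊α * n⌋₊)) :=
  (Measure.pi fun _ : Fin n × Fin ⌊α * n⌋₊ => bernoulliMeasure true false q).map bipartiteGraph

/-- The expected `p`-rank of the sandpile group of the random bipartite graph. -/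
def expectedPRank (p : ℕ) (n : ℕ) (α : ℝ) (q : unitInterval) : ℝ :=
  ∫ G, (pRank p G.SandpileGroup : ℝ) ∂(randomBipartiteGraph n α q)

end

/-!
The `p`-rank of the sandpile group of a connected graph differs by at most `1` from the corank over
`F = ZMod p` of its Laplacian (`pRank_sandpileGroup_of_connected`), and the random bipartite graph
is disconnected with exponentially small probability (`sum_columnsWeight_not_connected_le`). So it
suffices to compute the expected corank up to a bounded error.

Condition on the residues `d` modulo `p` of the degrees of the vertices in `L`; let `z` be the
number of those that vanish and `m = |R|`. Reveal the columns of the biadjacency matrix, that is the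
vertices in `R`, one at a time. The principal submatrix of the Laplacian on `L` alone is diagonal
and has corank `z`. By symmetry of the Laplacian, a new column changes the corank by at most `1`,
and lowers it by `1` unless the column is orthogonal to the kernel (`bipartiteCorank_cons_lt`).
While more than a fixed number of columns is still to come, the bits of the next column are
conditionally independent and none of them is nearly determined, because the law of a sum of many
bits is almost uniform modulo `p` (`exists_bitWeight_mul_bitSumLaw_le`). Hence Odlyzko's argument
(`sum_prod_orthogonal_le`) bounds the probability of orthogonality to the kernel by `ρ ^ c`, where
`c` is the corank and `ρ < 1`. This needs the kernel to be determined by its part on `L`, which is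
the case when the columns are linearly independent; since `α < 1`, they are, up to an exponentially
small probability. With these transition probabilities the expectation of `ρ⁻¹ ^ c` contracts by the
factor `ρ` in every step, up to an additive constant (`sum_revealWeight_pow_bipartiteCorank_le`), so
the expectation of the final corank is at most `max (z - m) 0 + O(1)`.
In any case it is at least `max (z - m) 0` (`sum_bipartiteCorank_bounds`).

The rows of the biadjacency matrix are independent, so `z` is binomial with parameters `n` and
`a = 1 / p + O(θ ^ m)`, where `θ < 1`, by Fourier analysis on `ZMod p`
(`exists_abs_bitSumLaw_sub_le`).
It remains to find the expectation of `max (z - m) 0`. If `α ≠ 1 / p`, the variance of `z` gives it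
up to `O(1)`. If `α = 1 / p`, de Moivre's identity for the mean deviation
(`sum_Ico_sub_mul_binomialWeight`) expresses it through a single binomial probability, which
Stirling's formula with an error term evaluates (`exists_abs_binomialExcess_sub_sqrt_le`).
-/

/-! ### Kernels of bipartite Laplacians over a field -/

section Kernel

variable {F L : Type*} [Field F]

/-- Dropping the coordinate of the column `0`. -/
def dropZero (F L : Type*) [Field F] (k : ℕ) :
    ((L → F) × (Fin (k + 1) → F)) →ₗ[F] ((L → F) × (Fin k → F)) :=
  LinearMap.prodMap LinearMap.id (LinearMap.funLeft F F Fin.succ)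

/-- Inserting the coordinate `0` at the column `0`. -/
def insertZero (F L : Type*) [Field F] (k : ℕ) :
    ((L → F) × (Fin k → F)) →ₗ[F] ((L → F) × (Fin (k + 1) → F)) where
  toFun z := (z.1, Fin.cons 0 z.2)
  map_add' z w := by
    refine Prod.ext rfl (funext fun i => ?_)
    refine Fin.cases ?_ (fun i => ?_) i <;> simp
  map_smul' c z := by
    refine Prod.ext rfl (funext fun i => ?_)
    refine Fin.cases ?_ (fun i => ?_) i <;> simp

lemma dropZero_injOn {k : ℕ} {z w : (L → F) × (Fin (k + 1) → F)} (hz : z.2 0 = w.2 0)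
    (h : dropZero F L k z = dropZero F L k w) : z = w := by
  simp only [dropZero, LinearMap.prodMap_apply, LinearMap.id_apply, Prod.mk.injEq] at h
  refine Prod.ext h.1 (funext fun i => ?_)
  refine Fin.cases hz (fun i => ?_) i
  exact congrFun h.2 i

variable [Fintype L]

/-- The Laplacian of a bipartite graph with sides `L` and `Fin k`, acting on pairs `(x, y)`, where
the columns `B i` of the biadjacency matrix have entries in a field. The diagonal entries at `L` are
a free parameter `d`; those at `Fin k` are the column sums of `B`. -/
def bipartiteLaplacian (d : L → F) {k : ℕ} (B : Fin k → L → F) :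
    ((L → F) × (Fin k → F)) →ₗ[F] ((L → F) × (Fin k → F)) where
  toFun z := (fun l => d l * z.1 l - ∑ i, B i l * z.2 i, fun i => ∑ l, B i l * (z.2 i - z.1 l))
  map_add' z w := by
    ext j
    · simp only [Prod.fst_add, Pi.add_apply, Prod.snd_add, mul_add, Finset.sum_add_distrib]; ring
    · simp only [Prod.fst_add, Pi.add_apply, Prod.snd_add, ← Finset.sum_add_distrib]
      exact Finset.sum_congr rfl fun l _ => by ring
  map_smul' c z := by
    ext j
    · simp only [Prod.smul_fst, Prod.smul_snd, Pi.smul_apply, smul_eq_mul, RingHom.id_apply,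
        mul_sub, Finset.mul_sum]
      congr 1
      · ring
      · exact Finset.sum_congr rfl fun l _ => by ring
    · simp only [Prod.smul_fst, Prod.smul_snd, Pi.smul_apply, smul_eq_mul, RingHom.id_apply,
        Finset.mul_sum]
      exact Finset.sum_congr rfl fun l _ => by ring

/-- The dimension of the kernel of `bipartiteLaplacian d B`. -/
noncomputable def bipartiteCorank (d : L → F) {k : ℕ} (B : Fin k → L → F) : ℕ :=
  Module.finrank F (LinearMap.ker (bipartiteLaplacian d B))

lemma mem_ker_bipartiteLaplacian {d : L → F} {k : ℕ} {B : Fin k → L → F}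
    {z : (L → F) × (Fin k → F)} :
    z ∈ LinearMap.ker (bipartiteLaplacian d B) ↔
      (∀ l, d l * z.1 l = ∑ i, B i l * z.2 i) ∧ ∀ i, ∑ l, B i l * z.1 l = (∑ l, B i l) * z.2 i := by
  simp only [LinearMap.mem_ker, bipartiteLaplacian, LinearMap.coe_mk, AddHom.coe_mk, Prod.ext_iff,
    funext_iff, Prod.fst_zero, Prod.snd_zero, Pi.zero_apply, sub_eq_zero, mul_sub,
    Finset.sum_sub_distrib, Finset.sum_mul]
  exact and_congr_right fun _ => forall_congr' fun i => eq_comm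

lemma mem_ker_cons_iff {d : L → F} {k : ℕ} {b : L → F} {B : Fin k → L → F}
    {z : (L → F) × (Fin (k + 1) → F)} (hz : z.2 0 = 0) :
    z ∈ LinearMap.ker (bipartiteLaplacian d (Fin.cons b B : Fin (k + 1) → L → F)) ↔
      dropZero F L k z ∈ LinearMap.ker (bipartiteLaplacian d B) ∧ ∑ l, b l * z.1 l = 0 := by
  simp only [mem_ker_bipartiteLaplacian, dropZero, Fin.sum_univ_succ, Fin.forall_fin_succ,
    Fin.cons_zero, Fin.cons_succ, hz, mul_zero, zero_add, LinearMap.prodMap_apply,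
    LinearMap.id_apply, LinearMap.funLeft_apply]
  tauto

lemma bipartiteCorank_cons_le (d : L → F) {k : ℕ} (b : L → F) (B : Fin k → L → F) :
    bipartiteCorank d (Fin.cons b B : Fin (k + 1) → L → F) ≤ bipartiteCorank d B + 1 := by
  set K := LinearMap.ker (bipartiteLaplacian d (Fin.cons b B : Fin (k + 1) → L → F)) with hK
  let f : K →ₗ[F] F := LinearMap.proj 0 ∘ₗ LinearMap.snd F _ _ ∘ₗ K.subtype
  have h1 := f.finrank_range_add_finrank_ker
  have h2 : Module.finrank F (LinearMap.range f) ≤ 1 := by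
    simpa using (LinearMap.range f).finrank_le
  have h3 : Module.finrank F (LinearMap.ker f) ≤ bipartiteCorank d B := by
    let g : LinearMap.ker f →ₗ[F] LinearMap.ker (bipartiteLaplacian d B) :=
      LinearMap.codRestrict _ (dropZero F L k ∘ₗ K.subtype ∘ₗ (LinearMap.ker f).subtype)
        fun z => ((mem_ker_cons_iff (z := z.1.1) z.2).1 z.1.2).1
    refine LinearMap.finrank_le_finrank_of_injective (f := g) fun z w hzw => ?_
    have h0 : z.1.1.2 0 = w.1.1.2 0 := (show z.1.1.2 0 = 0 from z.2).trans
      (show w.1.1.2 0 = 0 from w.2).symm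
    exact Subtype.ext (Subtype.ext (dropZero_injOn h0 (congrArg Subtype.val hzw)))
  rw [bipartiteCorank, ← hK]
  omega

lemma le_bipartiteCorank_cons (d : L → F) {k : ℕ} (b : L → F) (B : Fin k → L → F) :
    bipartiteCorank d B ≤ bipartiteCorank d (Fin.cons b B : Fin (k + 1) → L → F) + 1 := by
  set K := LinearMap.ker (bipartiteLaplacian d B) with hK
  let f : K →ₗ[F] F := (∑ l, b l • LinearMap.proj l) ∘ₗ LinearMap.fst F _ _ ∘ₗ K.subtype
  have hf : ∀ z : K, f z = ∑ l, b l * z.1.1 l := fun z => by simp [f]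
  have h1 := f.finrank_range_add_finrank_ker
  have h2 : Module.finrank F (LinearMap.range f) ≤ 1 := by
    simpa using (LinearMap.range f).finrank_le
  have h3 : Module.finrank F (LinearMap.ker f) ≤
      bipartiteCorank d (Fin.cons b B : Fin (k + 1) → L → F) := by
    let g : LinearMap.ker f →ₗ[F]
        LinearMap.ker (bipartiteLaplacian d (Fin.cons b B : Fin (k + 1) → L → F)) :=
      LinearMap.codRestrict _ (insertZero F L k ∘ₗ K.subtype ∘ₗ (LinearMap.ker f).subtype)
        fun z => by
          refine (mem_ker_cons_iff rfl).2 ⟨?_, ?_⟩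
          · exact z.1.2
          · exact (hf z.1).symm.trans z.2
    refine LinearMap.finrank_le_finrank_of_injective (f := g) fun z w hzw => ?_
    have h := congrArg (fun t => dropZero F L k t.1) hzw
    exact Subtype.ext (Subtype.ext h)
  rw [bipartiteCorank, ← hK]
  omega

/-- By symmetry of the Laplacian, a new column that is not orthogonal to the kernel leaves only
those kernel vectors which are orthogonal to it. -/
lemma bipartiteCorank_cons_lt {d : L → F} {k : ℕ} {b : L → F} {B : Fin k → L → F}
    {z₀ : (L → F) × (Fin k → F)} (hz₀ : z₀ ∈ LinearMap.ker (bipartiteLaplacian d B))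
    (hb : ∑ l, b l * z₀.1 l ≠ 0) :
    bipartiteCorank d (Fin.cons b B : Fin (k + 1) → L → F) < bipartiteCorank d B := by
  set K := LinearMap.ker (bipartiteLaplacian d (Fin.cons b B : Fin (k + 1) → L → F)) with hK
  have key : ∀ z ∈ K, z.2 0 = 0 := by
    intro z hz
    obtain ⟨h1, h2⟩ := mem_ker_bipartiteLaplacian.1 hz
    obtain ⟨h3, h4⟩ := mem_ker_bipartiteLaplacian.1 hz₀
    simp only [Fin.sum_univ_succ, Fin.cons_zero, Fin.cons_succ, Fin.forall_fin_succ] at h1 h2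
    -- both sides of `h` are `x₀ᵀ d x`, evaluated with the two systems of equations
    have h : ∑ l, z₀.1 l * (b l * z.2 0 + ∑ i : Fin k, B i l * z.2 i.succ) =
        ∑ l, z.1 l * ∑ i, B i l * z₀.2 i :=
      Finset.sum_congr rfl fun l _ => by rw [← h1 l, ← h3 l]; ring
    have e1 : ∑ l, z₀.1 l * ∑ i : Fin k, B i l * z.2 i.succ =
        ∑ i : Fin k, z.2 i.succ * ((∑ l, B i l) * z₀.2 i) := by
      simp_rw [← h4, Finset.mul_sum]
      rw [Finset.sum_comm]
      exact Finset.sum_congr rfl fun _ _ => Finset.sum_congr rfl fun _ _ => by ring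
    have e2 : ∑ l, z.1 l * ∑ i, B i l * z₀.2 i =
        ∑ i : Fin k, z.2 i.succ * ((∑ l, B i l) * z₀.2 i) := by
      have : ∀ i : Fin k, z.2 i.succ * ((∑ l, B i l) * z₀.2 i) =
          z₀.2 i * ∑ l, B i l * z.1 l := fun i => by rw [h2.2 i]; ring
      simp_rw [this, Finset.mul_sum]
      rw [Finset.sum_comm]
      exact Finset.sum_congr rfl fun _ _ => Finset.sum_congr rfl fun _ _ => by ring
    simp only [mul_add, Finset.sum_add_distrib, e1, e2, add_eq_right] at h
    have : (∑ l, b l * z₀.1 l) * z.2 0 = 0 := by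
      rw [← h, Finset.sum_mul]
      exact Finset.sum_congr rfl fun _ _ => by ring
    exact (mul_eq_zero.1 this).resolve_left hb
  have hlt : K.map (dropZero F L k) < LinearMap.ker (bipartiteLaplacian d B) := by
    refine lt_of_le_of_ne ?_ fun h => ?_
    · rintro _ ⟨z, hz, rfl⟩
      exact ((mem_ker_cons_iff (key z hz)).1 hz).1
    · rw [← h] at hz₀
      obtain ⟨z, hz, rfl⟩ := hz₀
      exact hb ((mem_ker_cons_iff (key z hz)).1 hz).2
  have h1 := Submodule.finrank_lt_finrank_of_lt hlt
  have h2 : Module.finrank F (K.map (dropZero F L k)) = Module.finrank F K := by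
    rw [← LinearMap.range_domRestrict]
    refine LinearMap.finrank_range_of_inj fun z w hzw => ?_
    exact Subtype.ext (dropZero_injOn ((key z z.2).trans (key w w.2).symm) hzw)
  rw [bipartiteCorank, ← hK, ← h2]
  exact h1

open Classical in
lemma bipartiteCorank_zero (d : L → F) (B : Fin 0 → L → F) :
    bipartiteCorank d B = (Finset.univ.filter fun l => d l = 0).card := by
  have e : LinearMap.ker (bipartiteLaplacian d B) ≃ₗ[F] ({l // d l = 0} → F) :=
    { toFun := fun z l => z.1.1 l
      map_add' := fun _ _ => rfl
      map_smul' := fun _ _ => rfl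
      invFun := fun x => ⟨(fun l => if h : d l = 0 then x ⟨l, h⟩ else 0, 0), by
        refine mem_ker_bipartiteLaplacian.2 ⟨fun l => ?_, fun i => i.elim0⟩
        by_cases h : d l = 0 <;> simp [h]⟩
      left_inv := fun z => by
        obtain ⟨h1, -⟩ := mem_ker_bipartiteLaplacian.1 z.2
        refine Subtype.ext (Prod.ext (funext fun l => ?_) (Subsingleton.elim _ _))
        by_cases h : d l = 0
        · simp [h]
        · have := h1 l
          simp only [Finset.univ_eq_empty, Finset.sum_empty, mul_eq_zero, h, false_or] at this
          simp [h, this]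
      right_inv := fun x => by
        ext l
        simp [l.2] }
  rw [bipartiteCorank, e.finrank_eq, Module.finrank_fintype_fun_eq_card, Fintype.card_subtype]

lemma bipartiteCorank_le (d : L → F) {k : ℕ} (B : Fin k → L → F) :
    bipartiteCorank d B ≤ Fintype.card L + k := by
  refine (Submodule.finrank_le _).trans ?_
  simp

/-- If the columns of the biadjacency matrix are independent, then a kernel vector is determined by
its part on `L`. -/
lemma finrank_map_fst_ker {d : L → F} {k : ℕ} {B : Fin k → L → F} (hB : LinearIndependent F B) :
    Module.finrank F ((LinearMap.ker (bipartiteLaplacian d B)).map (LinearMap.fst F _ _)) =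
      bipartiteCorank d B := by
  rw [← LinearMap.range_domRestrict]
  refine LinearMap.finrank_range_of_inj ?_
  rw [injective_iff_map_eq_zero]
  intro z hz
  have hz1 : z.1.1 = 0 := hz
  obtain ⟨h1, -⟩ := mem_ker_bipartiteLaplacian.1 z.2
  have h2 : ∑ i, z.1.2 i • B i = 0 := by
    ext l
    have := h1 l
    simp only [hz1, Pi.zero_apply, mul_zero] at this
    simp only [Finset.sum_apply, Pi.smul_apply, smul_eq_mul, Pi.zero_apply]
    rw [this]
    exact Finset.sum_congr rfl fun _ _ => mul_comm _ _
  exact Subtype.ext (Prod.ext hz1 (funext fun i => Fintype.linearIndependent_iff.1 hB _ h2 i))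

/-- The vectors that are orthogonal to `k` given vectors. -/
def orthogonalOf {k : ℕ} (B : Fin k → L → F) : Submodule F (L → F) :=
  LinearMap.ker (LinearMap.pi fun i => ∑ l, B i l • LinearMap.proj l : (L → F) →ₗ[F] Fin k → F)

lemma mem_orthogonalOf {k : ℕ} {B : Fin k → L → F} {x : L → F} :
    x ∈ orthogonalOf B ↔ ∀ i, ∑ l, B i l * x l = 0 := by
  simp [orthogonalOf, funext_iff]

lemma card_le_finrank_orthogonalOf {k : ℕ} (B : Fin k → L → F) :
    Fintype.card L ≤ Module.finrank F (orthogonalOf B) + k := by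
  have h := (LinearMap.pi fun i => ∑ l, B i l • LinearMap.proj l :
    (L → F) →ₗ[F] Fin k → F).finrank_range_add_finrank_ker
  have h2 := (LinearMap.range (LinearMap.pi fun i => ∑ l, B i l • LinearMap.proj l :
    (L → F) →ₗ[F] Fin k → F)).finrank_le
  simp only [Module.finrank_fintype_fun_eq_card, Fintype.card_fin] at h h2
  rw [orthogonalOf]
  omega

lemma orthogonal_of_mem_span {k : ℕ} {B : Fin k → L → F} {b : L → F}
    (hb : b ∈ Submodule.span F (Set.range B)) {x : L → F} (hx : x ∈ orthogonalOf B) :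
    ∑ l, b l * x l = 0 := by
  induction hb using Submodule.span_induction with
  | mem b hb => obtain ⟨i, rfl⟩ := hb; exact mem_orthogonalOf.1 hx i
  | zero => simp
  | add b c _ _ h1 h2 => simp [add_mul, Finset.sum_add_distrib, h1, h2]
  | smul a b _ h => simp [mul_assoc, ← Finset.mul_sum, h]

end Kernel

/-! ### Anticoncentration of random zero-one vectors on subspaces -/

section Odlyzko

variable {F : Type*} [Field F]

/-- A bit as an element of a ring. -/
def bit (F : Type*) [Field F] (β : Bool) : F := if β then 1 else 0

lemma bit_injective : Function.Injective (bit F) := by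
  intro a b h
  cases a <;> cases b <;> simp_all [bit]

open Classical in
/-- Odlyzko's bound: a random zero-one vector with independent coordinates, none of which takes a
value with probability more than `ρ`, is orthogonal to a `c`-dimensional space with probability at
most `ρ ^ c`, as `c` of its coordinates are determined by the others. The weights `a l` of the two
values of a coordinate need not add up to `1`. -/
lemma sum_prod_orthogonal_le {ρ : ℝ} (hρ : 0 ≤ ρ) :
    ∀ {n : ℕ} (a : Fin n → Bool → ℝ) (_ : ∀ l β, 0 ≤ a l β)
      (_ : ∀ l β, a l β ≤ ρ * ∑ γ, a l γ) (X : Submodule F (Fin n → F)),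
      ∑ b : Fin n → Bool, (if ∀ x ∈ X, ∑ l, bit F (b l) * x l = 0 then ∏ l, a l (b l) else 0) ≤
        ρ ^ Module.finrank F X * ∏ l, ∑ β, a l β := by
  intro n
  induction n with
  | zero =>
    intro a _ _ X
    have : Module.finrank F X = 0 := Nat.le_zero.1 (by simpa using X.finrank_le)
    simp [this]
  | succ n ih =>
    intro a ha hle X
    let X₀ : Submodule F (Fin (n + 1) → F) := X ⊓ LinearMap.ker (LinearMap.proj 0)
    let X' : Submodule F (Fin n → F) := X₀.map (LinearMap.funLeft F F Fin.succ)
    have hX' : Module.finrank F X' = Module.finrank F X₀ := by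
      change Module.finrank F (X₀.map (LinearMap.funLeft F F Fin.succ)) = _
      rw [← LinearMap.range_domRestrict]
      refine LinearMap.finrank_range_of_inj fun z w hzw => Subtype.ext (funext fun i => ?_)
      have hz : z.1 0 = 0 := z.2.2
      have hw : w.1 0 = 0 := w.2.2
      refine Fin.cases (hz.trans hw.symm) (fun i => ?_) i
      exact congrFun hzw i
    have hs : 0 ≤ ∑ β, a 0 β := Finset.sum_nonneg fun β _ => ha 0 β
    have ih' := ih (fun l => a l.succ) (fun l => ha l.succ) (fun l => hle l.succ) X'
    have hsplit : ∀ f : (Fin (n + 1) → Bool) → ℝ,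
        ∑ b, f b = ∑ b : Fin n → Bool, ∑ β, f (Fin.cons β b) := by
      intro f
      rw [← (Fin.consEquiv fun _ : Fin (n + 1) => Bool).sum_comp, Fintype.sum_prod_type_right]
      rfl
    -- a vector orthogonal to `X` has a tail orthogonal to `X'`
    have htail : ∀ (β : Bool) (b : Fin n → Bool),
        (∀ x ∈ X, ∑ l, bit F ((Fin.cons β b : Fin (n + 1) → Bool) l) * x l = 0) →
        ∀ x ∈ X', ∑ l, bit F (b l) * x l = 0 := by
      rintro β b h _ ⟨x, hx, rfl⟩
      have h0 : x 0 = 0 := hx.2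
      have := h x hx.1
      simpa [Fin.sum_univ_succ, h0, LinearMap.funLeft_apply] using this
    have hprod : 0 ≤ ∏ l : Fin n, ∑ β, a l.succ β :=
      Finset.prod_nonneg fun l _ => Finset.sum_nonneg fun β _ => ha _ β
    -- it suffices to bound the sum over the coordinate `0` by a multiple of its total weight
    suffices H : ∃ r : ℝ, 0 ≤ r ∧ r * ρ ^ Module.finrank F X' = ρ ^ Module.finrank F X ∧
        ∀ b : Fin n → Bool, ∑ β, (if ∀ x ∈ X, ∑ l,
          bit F ((Fin.cons β b : Fin (n + 1) → Bool) l) * x l = 0 then a 0 β else 0) ≤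
          r * ∑ β, a 0 β by
      obtain ⟨r, hr, hrρ, hb⟩ := H
      rw [hsplit, Fin.prod_univ_succ, ← hrρ]
      calc _ ≤ ∑ b : Fin n → Bool, (r * ∑ β, a 0 β) *
            (if ∀ x ∈ X', ∑ l, bit F (b l) * x l = 0 then ∏ l, a l.succ (b l) else 0) := by
            refine Finset.sum_le_sum fun b _ => ?_
            by_cases h : ∀ x ∈ X', ∑ l, bit F (b l) * x l = 0
            · rw [if_pos h]
              refine le_trans (le_of_eq ?_) (mul_le_mul_of_nonneg_right (hb b)
                (Finset.prod_nonneg fun l _ => ha _ _))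
              rw [Finset.sum_mul]
              refine Finset.sum_congr rfl fun β _ => ?_
              rw [ite_mul, zero_mul, Fin.prod_univ_succ]
              simp only [Fin.cons_zero, Fin.cons_succ]
            · rw [if_neg h, mul_zero]
              refine le_of_eq (Finset.sum_eq_zero fun β _ => if_neg fun h' => h (htail β b h'))
        _ ≤ (r * ∑ β, a 0 β) * (ρ ^ Module.finrank F X' * ∏ l : Fin n, ∑ β, a l.succ β) := by
            rw [← Finset.mul_sum]
            exact mul_le_mul_of_nonneg_left ih' (mul_nonneg hr hs)
        _ = _ := by ring
    by_cases h0 : ∃ x ∈ X, x 0 ≠ 0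
    · obtain ⟨x, hx, hx0⟩ := h0
      refine ⟨ρ, hρ, ?_, fun b => ?_⟩
      · let f : X →ₗ[F] F := LinearMap.proj 0 ∘ₗ X.subtype
        have h1 := f.finrank_range_add_finrank_ker
        have h2 : Module.finrank F (LinearMap.range f) = 1 := by
          have : LinearMap.range f = ⊤ := by
            rw [LinearMap.range_eq_top]
            refine LinearMap.surjective fun h => hx0 ?_
            exact LinearMap.congr_fun h ⟨x, hx⟩
          rw [this, finrank_top, Module.finrank_self]
        have h3 : Module.finrank F (LinearMap.ker f) = Module.finrank F X₀ := by
          have : X₀ = (LinearMap.ker f).map X.subtype := by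
            ext y
            simp only [X₀, f, Submodule.mem_inf, LinearMap.mem_ker, Submodule.mem_map,
              LinearMap.comp_apply, LinearMap.proj_apply, Submodule.subtype_apply]
            constructor
            · rintro ⟨h, h'⟩; exact ⟨⟨y, h⟩, h', rfl⟩
            · rintro ⟨y, h, rfl⟩; exact ⟨y.2, h⟩
          rw [this]
          exact (LinearEquiv.finrank_eq
            (Submodule.equivMapOfInjective _ X.subtype_injective _))
        rw [hX', ← h3, ← h1, h2, pow_add, pow_one]
      · -- the two values of the coordinate cannot both occur
        have huniq : ∀ β γ : Bool,
            (∀ x ∈ X, ∑ l, bit F ((Fin.cons β b : Fin (n + 1) → Bool) l) * x l = 0) →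
            (∀ x ∈ X, ∑ l, bit F ((Fin.cons γ b : Fin (n + 1) → Bool) l) * x l = 0) →
            β = γ := by
          intro β γ h h'
          have e := (h x hx).trans (h' x hx).symm
          simp only [Fin.sum_univ_succ, Fin.cons_zero, Fin.cons_succ, add_left_inj] at e
          exact bit_injective (mul_right_cancel₀ hx0 e)
        by_cases hβ : ∃ β, ∀ x ∈ X,
            ∑ l, bit F ((Fin.cons β b : Fin (n + 1) → Bool) l) * x l = 0
        · obtain ⟨β, hβ⟩ := hβ
          rw [Finset.sum_eq_single β, if_pos hβ]
          · exact hle 0 β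
          · intro γ _ hγ
            exact if_neg fun h => hγ (huniq _ _ h hβ)
          · simp
        · push Not at hβ
          rw [Finset.sum_eq_zero]
          · exact mul_nonneg hρ hs
          · intro β _
            refine if_neg fun h => ?_
            obtain ⟨x, hx, hne⟩ := hβ β
            exact hne (h x hx)
    · push Not at h0
      refine ⟨1, zero_le_one, ?_, fun b => ?_⟩
      · rw [one_mul, hX']
        have : X₀ = X := inf_eq_left.2 fun x hx => h0 x hx
        rw [this]
      · rw [one_mul]
        refine Finset.sum_le_sum fun β _ => ?_
        split_ifs
        · exact le_rfl
        · exact ha 0 β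

end Odlyzko

/-! ### Revealing the columns of a random matrix with given row sums -/

section Reveal

/-- The probability of a bit that is `true` with probability `q`. -/
def bitWeight (q : ℝ) (β : Bool) : ℝ := if β then q else 1 - q

lemma sum_bitWeight (q : ℝ) : ∑ β, bitWeight q β = 1 := by simp [bitWeight]

lemma bitWeight_nonneg {q : ℝ} (hq : q ∈ Set.Icc (0 : ℝ) 1) (β : Bool) : 0 ≤ bitWeight q β := by
  cases β <;> simp [bitWeight, hq.1, hq.2]

variable {F : Type*} [Field F]

variable (F) in
open Classical in
/-- The law of the sum, in `F`, of `N` independent bits that are `true` with probability `q`. -/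
noncomputable def bitSumLaw (q : ℝ) : ℕ → F → ℝ
  | 0, e => if e = 0 then 1 else 0
  | N + 1, e => ∑ β, bitWeight q β * bitSumLaw q N (e - bit F β)

lemma bitSumLaw_nonneg {q : ℝ} (hq : q ∈ Set.Icc (0 : ℝ) 1) (N : ℕ) (e : F) :
    0 ≤ bitSumLaw F q N e := by
  induction N generalizing e with
  | zero => simp only [bitSumLaw]; split_ifs <;> norm_num
  | succ N ih =>
    exact Finset.sum_nonneg fun β _ => mul_nonneg (bitWeight_nonneg hq β) (ih _)

variable {n k : ℕ}

/-- The probability that the first `k` columns of a random matrix with `k + N` columns are `B` and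
that its row sums in `F` are `d`. -/
noncomputable def revealWeight (q : ℝ) (N : ℕ) (d : Fin n → F) (B : Fin k → Fin n → Bool) : ℝ :=
  (∏ i, ∏ l, bitWeight q (B i l)) * ∏ l, bitSumLaw F q N (d l - ∑ i, bit F (B i l))

variable (F) in
/-- The columns of a matrix of bits as vectors over `F`. -/
def bitColumns (B : Fin k → Fin n → Bool) : Fin k → Fin n → F := fun i l => bit F (B i l)

lemma bitColumns_cons (b : Fin n → Bool) (B : Fin k → Fin n → Bool) :
    bitColumns F (Fin.cons b B : Fin (k + 1) → Fin n → Bool) =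
      Fin.cons (fun l => bit F (b l)) (bitColumns F B) := by
  funext i
  refine Fin.cases ?_ (fun i => ?_) i
  · rfl
  · rfl

lemma revealWeight_nonneg {q : ℝ} (hq : q ∈ Set.Icc (0 : ℝ) 1) (N : ℕ) (d : Fin n → F)
    (B : Fin k → Fin n → Bool) : 0 ≤ revealWeight q N d B :=
  mul_nonneg (Finset.prod_nonneg fun _ _ => Finset.prod_nonneg fun _ _ => bitWeight_nonneg hq _)
    (Finset.prod_nonneg fun _ _ => bitSumLaw_nonneg hq _ _)

lemma revealWeight_cons (q : ℝ) (N : ℕ) (d : Fin n → F) (b : Fin n → Bool)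
    (B : Fin k → Fin n → Bool) :
    revealWeight q N d (Fin.cons b B : Fin (k + 1) → Fin n → Bool) =
      (∏ i, ∏ l, bitWeight q (B i l)) * ∏ l, (bitWeight q (b l) *
        bitSumLaw F q N (d l - ∑ i, bit F (B i l) - bit F (b l))) := by
  simp only [revealWeight, Fin.prod_univ_succ, Fin.sum_univ_succ, Fin.cons_zero, Fin.cons_succ,
    Finset.prod_mul_distrib, sub_sub, add_comm]
  ring

lemma sum_revealWeight_cons (q : ℝ) (N : ℕ) (d : Fin n → F) (B : Fin k → Fin n → Bool) :
    ∑ b : Fin n → Bool, revealWeight q N d (Fin.cons b B : Fin (k + 1) → Fin n → Bool) =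
      revealWeight q (N + 1) d B := by
  simp only [revealWeight_cons, ← Finset.mul_sum]
  rw [revealWeight]
  congr 1
  simp only [bitSumLaw]
  rw [Finset.prod_univ_sum, Fintype.piFinset_univ]

lemma sum_fin_succ_eq (f : (Fin (k + 1) → Fin n → Bool) → ℝ) :
    ∑ B, f B = ∑ B : Fin k → Fin n → Bool, ∑ b, f (Fin.cons b B) := by
  rw [← (Fin.consEquiv fun _ : Fin (k + 1) => Fin n → Bool).sum_comp, Fintype.sum_prod_type_right]
  rfl

lemma sum_revealWeight (q : ℝ) (N k : ℕ) (d : Fin n → F) :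
    ∑ B : Fin k → Fin n → Bool, revealWeight q N d B = ∏ l, bitSumLaw F q (N + k) (d l) := by
  induction k generalizing N with
  | zero => simp [revealWeight]
  | succ k ih =>
    rw [sum_fin_succ_eq]
    simp only [sum_revealWeight_cons]
    rw [ih, add_right_comm, add_assoc]

open Classical in
/-- While every bit of the next column keeps, given the past, a chance of at least `1 - ρ` for both
values, the next column is orthogonal to a `c`-dimensional space with conditional probability at
most `ρ ^ c`. -/
lemma sum_revealWeight_orthogonal_le {q ρ : ℝ} (hq : q ∈ Set.Icc (0 : ℝ) 1) (hρ : 0 ≤ ρ) {N : ℕ}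
    (h : ∀ (e : F) (β : Bool),
      bitWeight q β * bitSumLaw F q N (e - bit F β) ≤ ρ * bitSumLaw F q (N + 1) e)
    (d : Fin n → F) (B : Fin k → Fin n → Bool) (X : Submodule F (Fin n → F)) :
    ∑ b : Fin n → Bool, (if ∀ x ∈ X, ∑ l, bit F (b l) * x l = 0 then
      revealWeight q N d (Fin.cons b B : Fin (k + 1) → Fin n → Bool) else 0) ≤
      ρ ^ Module.finrank F X * revealWeight q (N + 1) d B := by
  have key := sum_prod_orthogonal_le hρ
    (fun l β => bitWeight q β * bitSumLaw F q N (d l - ∑ i, bit F (B i l) - bit F β))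
    (fun l β => mul_nonneg (bitWeight_nonneg hq β) (bitSumLaw_nonneg hq _ _))
    (fun l β => h _ β) X
  have h0 : 0 ≤ ∏ i, ∏ l, bitWeight q (B i l) :=
    Finset.prod_nonneg fun _ _ => Finset.prod_nonneg fun _ _ => bitWeight_nonneg hq _
  have := mul_le_mul_of_nonneg_left key h0
  rw [Finset.mul_sum] at this
  simp only [revealWeight_cons, mul_ite, mul_zero] at this ⊢
  refine this.trans (le_of_eq ?_)
  rw [revealWeight, mul_left_comm]
  rfl

open Classical in
/-- With high probability the columns of the biadjacency matrix are independent. -/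
lemma sum_revealWeight_not_linearIndependent_le {q ρ : ℝ} (hq : q ∈ Set.Icc (0 : ℝ) 1)
    (hρ : 0 ≤ ρ) (hρ1 : ρ ≤ 1) {K : ℕ}
    (h : ∀ N, K ≤ N → ∀ (e : F) (β : Bool),
      bitWeight q β * bitSumLaw F q N (e - bit F β) ≤ ρ * bitSumLaw F q (N + 1) e)
    (d : Fin n → F) (k N : ℕ) (hN : K ≤ N) :
    ∑ B : Fin k → Fin n → Bool,
      (if LinearIndependent F (bitColumns F B) then 0 else revealWeight q N d B) ≤
      k * ρ ^ (n - k) * ∏ l, bitSumLaw F q (N + k) (d l) := by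
  induction k generalizing N with
  | zero => simp
  | succ k ih =>
    have hP : 0 ≤ ∏ l, bitSumLaw F q (N + (k + 1)) (d l) :=
      Finset.prod_nonneg fun _ _ => bitSumLaw_nonneg hq _ _
    have hstep : ∀ B : Fin k → Fin n → Bool,
        ∑ b, (if LinearIndependent F (bitColumns F (Fin.cons b B : Fin (k + 1) → Fin n → Bool))
          then 0 else revealWeight q N d (Fin.cons b B : Fin (k + 1) → Fin n → Bool)) ≤
        (if LinearIndependent F (bitColumns F B) then 0 else revealWeight q (N + 1) d B) +
          ρ ^ (n - k) * revealWeight q (N + 1) d B := by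
      intro B
      have hW := fun b => revealWeight_nonneg hq N d
        (Fin.cons b B : Fin (k + 1) → Fin n → Bool)
      by_cases hB : LinearIndependent F (bitColumns F B)
      · rw [if_pos hB, zero_add]
        have h1 := sum_revealWeight_orthogonal_le hq hρ (h N hN) d B
          (orthogonalOf (bitColumns F B))
        refine (Finset.sum_le_sum fun b _ => ?_).trans (h1.trans ?_)
        · rw [bitColumns_cons, linearIndependent_finCons]
          by_cases hb : (fun l => bit F (b l)) ∈ Submodule.span F (Set.range (bitColumns F B))
          · rw [if_neg (fun h' => h'.2 hb), if_pos]
            exact fun x hx => orthogonal_of_mem_span hb hx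
          · rw [if_pos ⟨hB, hb⟩]
            split_ifs
            · exact hW b
            · exact le_rfl
        · refine mul_le_mul_of_nonneg_right (pow_le_pow_of_le_one hρ hρ1 ?_)
            (revealWeight_nonneg hq _ _ _)
          have := card_le_finrank_orthogonalOf (bitColumns F B)
          rw [Fintype.card_fin] at this
          omega
      · rw [if_neg hB]
        refine le_add_of_le_of_nonneg ?_
          (mul_nonneg (pow_nonneg hρ _) (revealWeight_nonneg hq _ _ _))
        rw [← sum_revealWeight_cons]
        refine Finset.sum_le_sum fun b _ => ?_
        split_ifs
        · exact hW b
        · exact le_rfl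
    rw [sum_fin_succ_eq]
    refine (Finset.sum_le_sum fun B _ => hstep B).trans ?_
    rw [Finset.sum_add_distrib, ← Finset.mul_sum, sum_revealWeight]
    have e : N + 1 + k = N + (k + 1) := by ring
    have ih' := ih (N + 1) (by omega)
    rw [e] at ih' ⊢
    have hpow : ρ ^ (n - k) ≤ ρ ^ (n - (k + 1)) := pow_le_pow_of_le_one hρ hρ1 (by omega)
    calc _ ≤ k * ρ ^ (n - k) * ∏ l, bitSumLaw F q (N + (k + 1)) (d l) +
          ρ ^ (n - k) * ∏ l, bitSumLaw F q (N + (k + 1)) (d l) := by gcongr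
      _ = (k + 1) * ρ ^ (n - k) * ∏ l, bitSumLaw F q (N + (k + 1)) (d l) := by ring
      _ ≤ _ := by push_cast; gcongr

open Classical in
/-- The Lyapunov estimate. If the corank `c` is followed by `c - 1` with probability at least
`1 - ρ ^ c` and by at most `c + 1` otherwise, then the expectation of `ρ⁻¹ ^ c` is multiplied by
`ρ`, up to an additive constant, in every step. -/
lemma sum_revealWeight_pow_bipartiteCorank_le {q ρ : ℝ} (hq : q ∈ Set.Icc (0 : ℝ) 1)
    (hρ : 0 < ρ) (hρ1 : ρ < 1) {K : ℕ}
    (h : ∀ N, K ≤ N → ∀ (e : F) (β : Bool),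
      bitWeight q β * bitSumLaw F q N (e - bit F β) ≤ ρ * bitSumLaw F q (N + 1) e)
    (d : Fin n → F) (k N : ℕ) (hN : K ≤ N) :
    ∑ B : Fin k → Fin n → Bool, (if LinearIndependent F (bitColumns F B) then
      revealWeight q N d B * ρ⁻¹ ^ bipartiteCorank d (bitColumns F B) else 0) ≤
      (ρ ^ k * ρ⁻¹ ^ (Finset.univ.filter fun l => d l = 0).card + ρ⁻¹ / (1 - ρ)) *
        ∏ l, bitSumLaw F q (N + k) (d l) := by
  have hρi : 0 < ρ⁻¹ := inv_pos.2 hρ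
  have hρi1 : 1 ≤ ρ⁻¹ := (one_le_inv₀ hρ).2 hρ1.le
  have h1ρ : 0 < 1 - ρ := sub_pos.2 hρ1
  induction k generalizing N with
  | zero =>
    have hP : 0 ≤ ∏ l, bitSumLaw F q N (d l) :=
      Finset.prod_nonneg fun _ _ => bitSumLaw_nonneg hq _ _
    have : 0 ≤ ρ⁻¹ / (1 - ρ) := by positivity
    simp only [bipartiteCorank_zero, linearIndependent_empty_type, if_true, ← Finset.sum_mul,
      sum_revealWeight, add_zero, pow_zero, one_mul]
    nlinarith
  | succ k ih =>
    have hP : 0 ≤ ∏ l, bitSumLaw F q (N + (k + 1)) (d l) :=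
      Finset.prod_nonneg fun _ _ => bitSumLaw_nonneg hq _ _
    have hstep : ∀ B : Fin k → Fin n → Bool,
        ∑ b, (if LinearIndependent F (bitColumns F (Fin.cons b B : Fin (k + 1) → Fin n → Bool))
          then revealWeight q N d (Fin.cons b B : Fin (k + 1) → Fin n → Bool) *
            ρ⁻¹ ^ bipartiteCorank d
              (bitColumns F (Fin.cons b B : Fin (k + 1) → Fin n → Bool)) else 0) ≤
        ρ * (if LinearIndependent F (bitColumns F B) then
          revealWeight q (N + 1) d B * ρ⁻¹ ^ bipartiteCorank d (bitColumns F B) else 0) +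
          ρ⁻¹ * revealWeight q (N + 1) d B := by
      intro B
      have hW := fun b => revealWeight_nonneg hq N d
        (Fin.cons b B : Fin (k + 1) → Fin n → Bool)
      have hW1 := revealWeight_nonneg hq (N + 1) d B
      by_cases hB : LinearIndependent F (bitColumns F B)
      swap
      · rw [if_neg hB, Finset.sum_eq_zero]
        · positivity
        · intro b _
          rw [bitColumns_cons, linearIndependent_finCons, if_neg fun h' => hB h'.1]
      rw [if_pos hB]
      set c := bipartiteCorank d (bitColumns F B) with hc
      set X := (LinearMap.ker (bipartiteLaplacian d (bitColumns F B))).map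
        (LinearMap.fst F _ _) with hX
      have hXc : Module.finrank F X = c := finrank_map_fst_ker hB
      have h1 := sum_revealWeight_orthogonal_le hq hρ.le (h N hN) d B X
      rw [hXc] at h1
      calc _ ≤ ∑ b : Fin n → Bool,
            (ρ * (revealWeight q N d (Fin.cons b B : Fin (k + 1) → Fin n → Bool) * ρ⁻¹ ^ c) +
            ρ⁻¹ ^ (c + 1) * (if ∀ x ∈ X, ∑ l, bit F (b l) * x l = 0 then
              revealWeight q N d (Fin.cons b B : Fin (k + 1) → Fin n → Bool) else 0)) := by
            refine Finset.sum_le_sum fun b _ => ?_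
            have hWb := hW b
            set w := revealWeight q N d (Fin.cons b B : Fin (k + 1) → Fin n → Bool)
            have hnn : 0 ≤ ρ * (w * ρ⁻¹ ^ c) := by positivity
            by_cases hb : ∀ x ∈ X, ∑ l, bit F (b l) * x l = 0
            · rw [if_pos hb]
              refine le_add_of_nonneg_of_le hnn ?_
              split_ifs
              · rw [mul_comm]
                refine mul_le_mul_of_nonneg_right (pow_le_pow_right₀ hρi1 ?_) hWb
                rw [bitColumns_cons]
                exact bipartiteCorank_cons_le d _ _
              · positivity
            · rw [if_neg hb, mul_zero, add_zero]
              push Not at hb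
              obtain ⟨_, ⟨z, hz, rfl⟩, hne⟩ := hb
              have hlt := bipartiteCorank_cons_lt (b := fun l => bit F (b l)) hz hne
              rw [← bitColumns_cons, ← hc] at hlt
              split_ifs
              · obtain ⟨c', hc'⟩ : ∃ c', c = c' + 1 := ⟨c - 1, by omega⟩
                have : ρ * (w * ρ⁻¹ ^ c) = w * ρ⁻¹ ^ c' := by
                  rw [hc', pow_succ]; field_simp
                rw [this]
                exact mul_le_mul_of_nonneg_left (pow_le_pow_right₀ hρi1 (by omega)) hWb
              · exact hnn
        _ = ρ * (revealWeight q (N + 1) d B * ρ⁻¹ ^ c) +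
            ρ⁻¹ ^ (c + 1) * ∑ b : Fin n → Bool,
              (if ∀ x ∈ X, ∑ l, bit F (b l) * x l = 0 then
                revealWeight q N d (Fin.cons b B : Fin (k + 1) → Fin n → Bool) else 0) := by
            rw [Finset.sum_add_distrib, ← Finset.mul_sum, ← Finset.sum_mul,
              sum_revealWeight_cons, ← Finset.mul_sum]
        _ ≤ ρ * (revealWeight q (N + 1) d B * ρ⁻¹ ^ c) +
            ρ⁻¹ ^ (c + 1) * (ρ ^ c * revealWeight q (N + 1) d B) := by gcongr
        _ = _ := by
            congr 1
            rw [pow_succ, inv_pow]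
            field_simp
    rw [sum_fin_succ_eq]
    refine (Finset.sum_le_sum fun B _ => hstep B).trans ?_
    rw [Finset.sum_add_distrib, ← Finset.mul_sum, ← Finset.mul_sum, sum_revealWeight]
    have e : N + 1 + k = N + (k + 1) := by ring
    have ih' := ih (N + 1) (by omega)
    rw [e] at ih' ⊢
    refine (add_le_add_left (mul_le_mul_of_nonneg_left ih' hρ.le) _).trans (le_of_eq ?_)
    have : ρ⁻¹ = ρ * (ρ⁻¹ / (1 - ρ)) * (-1) + ρ⁻¹ / (1 - ρ) := by field_simp; ring
    rw [pow_succ]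
    linear_combination (∏ l, bitSumLaw F q (N + (k + 1)) (d l)) * this

/-- Bernoulli's inequality, as used to pass from exponential moments to expectations. -/
lemma natCast_le_add_pow {ρ : ℝ} (hρ : 0 < ρ) (hρ1 : ρ < 1) (c a : ℕ) :
    (c : ℝ) ≤ a + ρ⁻¹ ^ c * ρ ^ a / (ρ⁻¹ - 1) := by
  have h1 : 0 < ρ⁻¹ - 1 := sub_pos.2 ((one_lt_inv₀ hρ).2 hρ1)
  rcases le_total c a with hca | hca
  · have : (c : ℝ) ≤ a := by exact_mod_cast hca
    have : 0 ≤ ρ⁻¹ ^ c * ρ ^ a / (ρ⁻¹ - 1) := by positivity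
    linarith
  · obtain ⟨t, rfl⟩ := Nat.exists_eq_add_of_le hca
    have h2 : ρ⁻¹ ^ (a + t) * ρ ^ a = ρ⁻¹ ^ t := by
      rw [pow_add, mul_right_comm, ← mul_pow, inv_mul_cancel₀ hρ.ne', one_pow, one_mul]
    have h3 := one_add_mul_le_pow (a := ρ⁻¹ - 1) (by linarith) t
    rw [add_sub_cancel] at h3
    rw [h2, Nat.cast_add, add_le_add_iff_left, le_div_iff₀ h1]
    linarith

open Classical in
/-- Given the row sums `d`, the expected corank is at most the excess of the number of zeros of `d`
over the number of columns, up to a constant and a negligible error. -/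
lemma sum_revealWeight_bipartiteCorank_le {q ρ : ℝ} (hq : q ∈ Set.Icc (0 : ℝ) 1)
    (hρ : 0 < ρ) (hρ1 : ρ < 1) {K : ℕ}
    (h : ∀ N, K ≤ N → ∀ (e : F) (β : Bool),
      bitWeight q β * bitSumLaw F q N (e - bit F β) ≤ ρ * bitSumLaw F q (N + 1) e)
    (d : Fin n → F) (k N : ℕ) (hN : K ≤ N) :
    ∑ B : Fin k → Fin n → Bool, revealWeight q N d B * bipartiteCorank d (bitColumns F B) ≤
      (((Finset.univ.filter fun l => d l = 0).card - k : ℕ) +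
        (1 + ρ⁻¹ / (1 - ρ)) / (ρ⁻¹ - 1) + (n + k) * (k * ρ ^ (n - k))) *
        ∏ l, bitSumLaw F q (N + k) (d l) := by
  have h1 : 0 < ρ⁻¹ - 1 := sub_pos.2 ((one_lt_inv₀ hρ).2 hρ1)
  have h1ρ : 0 < 1 - ρ := sub_pos.2 hρ1
  set P := ∏ l, bitSumLaw F q (N + k) (d l) with hPdef
  have hP : 0 ≤ P := Finset.prod_nonneg fun _ _ => bitSumLaw_nonneg hq _ _
  set z := (Finset.univ.filter fun l => d l = 0).card with hz
  set a := z - k with ha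
  have hA := sum_revealWeight_pow_bipartiteCorank_le hq hρ hρ1 h d k N hN
  have hG := sum_revealWeight_not_linearIndependent_le hq hρ.le hρ1.le h d k N hN
  rw [← hPdef] at hG
  rw [← hPdef, ← hz] at hA
  have hpt : ∀ B : Fin k → Fin n → Bool,
      revealWeight q N d B * bipartiteCorank d (bitColumns F B) ≤
      a * revealWeight q N d B + (ρ ^ a / (ρ⁻¹ - 1)) *
        (if LinearIndependent F (bitColumns F B) then
          revealWeight q N d B * ρ⁻¹ ^ bipartiteCorank d (bitColumns F B) else 0) +
        (n + k) * (if LinearIndependent F (bitColumns F B) then 0 else revealWeight q N d B) := by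
    intro B
    have hW := revealWeight_nonneg hq N d B
    split_ifs
    · have := mul_le_mul_of_nonneg_left
        (natCast_le_add_pow hρ hρ1 (bipartiteCorank d (bitColumns F B)) a) hW
      refine this.trans (le_of_eq ?_)
      ring
    · have h2 : (bipartiteCorank d (bitColumns F B) : ℝ) ≤ n + k := by
        have := bipartiteCorank_le d (bitColumns F B)
        rw [Fintype.card_fin] at this
        exact_mod_cast this
      have h3 : 0 ≤ (a : ℝ) * revealWeight q N d B := by positivity
      have := mul_le_mul_of_nonneg_left h2 hW
      linarith
  refine (Finset.sum_le_sum fun B _ => hpt B).trans ?_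
  rw [Finset.sum_add_distrib, Finset.sum_add_distrib, ← Finset.mul_sum, ← Finset.mul_sum,
    ← Finset.mul_sum, sum_revealWeight, ← hPdef]
  have h4 : ρ ^ a * (ρ ^ k * ρ⁻¹ ^ z) ≤ 1 := by
    have : ρ ^ (a + k) ≤ ρ ^ z := pow_le_pow_of_le_one hρ.le hρ1.le (by omega)
    calc ρ ^ a * (ρ ^ k * ρ⁻¹ ^ z) = ρ ^ (a + k) * ρ⁻¹ ^ z := by rw [pow_add]; ring
      _ ≤ ρ ^ z * ρ⁻¹ ^ z := by gcongr
      _ = 1 := by rw [← mul_pow, mul_inv_cancel₀ hρ.ne', one_pow]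
  have h5 : ρ ^ a * (ρ⁻¹ / (1 - ρ)) ≤ ρ⁻¹ / (1 - ρ) :=
    mul_le_of_le_one_left (by positivity) (pow_le_one₀ hρ.le hρ1.le)
  calc _ ≤ a * P + ρ ^ a / (ρ⁻¹ - 1) * ((ρ ^ k * ρ⁻¹ ^ z + ρ⁻¹ / (1 - ρ)) * P) +
        (n + k) * (k * ρ ^ (n - k) * P) := by gcongr
    _ = (a + (ρ ^ a * (ρ ^ k * ρ⁻¹ ^ z) + ρ ^ a * (ρ⁻¹ / (1 - ρ))) / (ρ⁻¹ - 1) +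
        (n + k) * (k * ρ ^ (n - k))) * P := by ring
    _ ≤ _ := by gcongr

/-- Each of the last columns raises the expected corank by at most `1`. -/
lemma sum_revealWeight_bipartiteCorank_le_add {q : ℝ} (hq : q ∈ Set.Icc (0 : ℝ) 1)
    (d : Fin n → F) (k j N : ℕ) :
    ∑ B : Fin (k + j) → Fin n → Bool, revealWeight q N d B * bipartiteCorank d (bitColumns F B) ≤
      ∑ B : Fin k → Fin n → Bool,
        revealWeight q (N + j) d B * bipartiteCorank d (bitColumns F B) +
        j * ∏ l, bitSumLaw F q (N + (k + j)) (d l) := by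
  induction j generalizing N with
  | zero => simp
  | succ j ih =>
    have e : N + 1 + (k + j) = N + (k + (j + 1)) := by ring
    have ih' := ih (N + 1)
    rw [e, show N + 1 + j = N + (j + 1) by ring] at ih'
    have : ∑ B : Fin (k + (j + 1)) → Fin n → Bool,
        revealWeight q N d B * bipartiteCorank d (bitColumns F B) ≤
        ∑ B : Fin (k + j) → Fin n → Bool,
          revealWeight q (N + 1) d B * bipartiteCorank d (bitColumns F B) +
          ∏ l, bitSumLaw F q (N + (k + (j + 1))) (d l) := by
      change ∑ B : Fin (k + j + 1) → Fin n → Bool, _ ≤ _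
      rw [sum_fin_succ_eq, ← e, ← sum_revealWeight, ← Finset.sum_add_distrib]
      refine Finset.sum_le_sum fun B _ => ?_
      rw [← mul_add_one, ← sum_revealWeight_cons, Finset.sum_mul]
      refine Finset.sum_le_sum fun b _ => mul_le_mul_of_nonneg_left ?_
        (revealWeight_nonneg hq _ _ _)
      rw [bitColumns_cons]
      exact_mod_cast bipartiteCorank_cons_le d _ _
    refine this.trans ?_
    push_cast
    linarith

open Classical in
lemma card_zeros_le_bipartiteCorank_add (d : Fin n → F) (B : Fin k → Fin n → F) :
    (Finset.univ.filter fun l => d l = 0).card ≤ bipartiteCorank d B + k := by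
  induction k with
  | zero => rw [bipartiteCorank_zero]; omega
  | succ k ih =>
    have h1 := ih (Fin.tail B)
    have h2 := le_bipartiteCorank_cons d (B 0) (Fin.tail B)
    rw [Fin.cons_self_tail] at h2
    omega

variable [Fintype F]

open Classical in
lemma sum_revealWeight_zero_mul (q : ℝ) (f : (Fin n → F) → (Fin k → Fin n → Bool) → ℝ) :
    ∑ d : Fin n → F, ∑ B, revealWeight q 0 d B * f d B =
      ∑ B : Fin k → Fin n → Bool, (∏ i, ∏ l, bitWeight q (B i l)) *
        f (fun l => ∑ i, bit F (B i l)) B := by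
  rw [Finset.sum_comm]
  refine Finset.sum_congr rfl fun B _ => ?_
  rw [Finset.sum_eq_single fun l => ∑ i, bit F (B i l)]
  · simp [revealWeight, bitSumLaw]
  · intro d _ hd
    obtain ⟨l, hl⟩ := Function.ne_iff.1 hd
    have : ∏ l, bitSumLaw F q 0 (d l - ∑ i, bit F (B i l)) = 0 :=
      Finset.prod_eq_zero (Finset.mem_univ l) (by simp [bitSumLaw, sub_eq_zero, hl])
    simp [revealWeight, this]
  · simp

open Classical in
/-- The expected corank of the Laplacian of the random bipartite graph over `F` is the expected
excess of the number of zero row sums over the number of columns, up to a bounded error. -/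
lemma sum_bipartiteCorank_bounds {q ρ : ℝ} (hq : q ∈ Set.Icc (0 : ℝ) 1)
    (hρ : 0 < ρ) (hρ1 : ρ < 1) {K : ℕ}
    (h : ∀ N, K ≤ N → ∀ (e : F) (β : Bool),
      bitWeight q β * bitSumLaw F q N (e - bit F β) ≤ ρ * bitSumLaw F q (N + 1) e)
    (n m : ℕ) (hK : K ≤ m) (hm : m ≤ n) :
    let S := ∑ B : Fin m → Fin n → Bool, (∏ i, ∏ l, bitWeight q (B i l)) *
      (bipartiteCorank (fun l => ∑ i, bit F (B i l)) (bitColumns F B) : ℝ)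
    let T := ∑ d : Fin n → F, (∏ l, bitSumLaw F q m (d l)) *
      (((Finset.univ.filter fun l => d l = 0).card - m : ℕ) : ℝ)
    T ≤ S ∧ S ≤ T + ((1 + ρ⁻¹ / (1 - ρ)) / (ρ⁻¹ - 1) + 2 * K + 2 * n * (n * ρ ^ (n - m))) *
      (∑ e, bitSumLaw F q m e) ^ n := by
  intro S T
  have hS : S = ∑ d : Fin n → F, ∑ B : Fin m → Fin n → Bool,
      revealWeight q 0 d B * bipartiteCorank d (bitColumns F B) :=
    (sum_revealWeight_zero_mul q fun d B => (bipartiteCorank d (bitColumns F B) : ℝ)).symm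
  have hP : ∀ (N : ℕ) (d : Fin n → F), 0 ≤ ∏ l, bitSumLaw F q N (d l) := fun N d =>
    Finset.prod_nonneg fun _ _ => bitSumLaw_nonneg hq _ _
  rw [hS]
  constructor
  · refine Finset.sum_le_sum fun d _ => ?_
    have := sum_revealWeight q 0 m d
    rw [zero_add] at this
    rw [← this, Finset.sum_mul]
    refine Finset.sum_le_sum fun B _ => mul_le_mul_of_nonneg_left ?_
      (revealWeight_nonneg hq _ _ _)
    have := card_zeros_le_bipartiteCorank_add d (bitColumns F B)
    exact_mod_cast (by omega)
  · have hpow : (∑ e, bitSumLaw F q m e) ^ n = ∑ d : Fin n → F, ∏ l, bitSumLaw F q m (d l) := by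
      rw [← Fintype.piFinset_univ, ← Finset.prod_univ_sum]
      simp
    rw [hpow, Finset.mul_sum, ← Finset.sum_add_distrib]
    refine Finset.sum_le_sum fun d _ => ?_
    obtain ⟨k, rfl⟩ : ∃ k, m = k + K := ⟨m - K, by omega⟩
    have h1 := sum_revealWeight_bipartiteCorank_le_add hq d k K 0
    have h2 := sum_revealWeight_bipartiteCorank_le hq hρ hρ1 h d k K le_rfl
    rw [zero_add, zero_add] at h1
    rw [add_comm K k] at h2
    set z := (Finset.univ.filter fun l => d l = 0).card
    have h3 : ((z - k : ℕ) : ℝ) ≤ ((z - (k + K) : ℕ) : ℝ) + K := by exact_mod_cast (by omega)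
    have h4 : ((n : ℝ) + k) * (k * ρ ^ (n - k)) ≤ 2 * n * (n * ρ ^ (n - (k + K))) := by
      have hkn : (k : ℝ) ≤ n := by exact_mod_cast (by omega)
      have : ρ ^ (n - k) ≤ ρ ^ (n - (k + K)) := pow_le_pow_of_le_one hρ.le hρ1.le (by omega)
      gcongr
      linarith
    have h5 := hP (k + K) d
    set P := ∏ l, bitSumLaw F q (k + K) (d l)
    refine h1.trans ((add_le_add_left h2 _).trans ?_)
    rw [← add_mul, mul_comm P, ← add_mul]
    refine mul_le_mul_of_nonneg_right ?_ h5
    linarith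

lemma sum_bitSumLaw (q : ℝ) (N : ℕ) : ∑ e, bitSumLaw F q N e = 1 := by
  induction N with
  | zero =>
    simp only [bitSumLaw]
    rw [Finset.sum_eq_single 0 (fun _ _ h => if_neg h) (by simp), if_pos rfl]
  | succ N ih =>
    simp only [bitSumLaw]
    rw [Finset.sum_comm]
    simp only [← Finset.mul_sum]
    have : ∀ β, ∑ e, bitSumLaw F q N (e - bit F β) = 1 := fun β =>
      ((Equiv.subRight (bit F β)).sum_comp _).trans ih
    simp only [this, mul_one]
    exact sum_bitWeight q

end Reveal

/-! ### The `p`-rank of a sandpile group and the kernel of the Laplacian modulo `p` -/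

/-- The corank of a square matrix over a field: the dimension of its kernel. -/
noncomputable def Matrix.corank {F ι : Type*} [Field F] [Fintype ι] (A : Matrix ι ι F) : ℕ :=
  Module.finrank F (LinearMap.ker A.mulVecLin)

lemma Matrix.rank_add_corank {F ι : Type*} [Field F] [Fintype ι] (A : Matrix ι ι F) :
    A.rank + A.corank = Fintype.card ι := by
  rw [Matrix.rank, Matrix.corank, A.mulVecLin.finrank_range_add_finrank_ker,
    Module.finrank_fintype_fun_eq_card]

section PRank

variable {p : ℕ}

lemma modN_mk_eq_zero_iff {A : Type*} [AddCommGroup A] {a : A} :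
    ModN.mkQ p a = 0 ↔ ∃ b, p • b = a := by
  change (Submodule.Quotient.mk a : ModN A p) = 0 ↔ _
  rw [Submodule.Quotient.mk_eq_zero]
  simp

lemma modN_mkQ_surjective (p : ℕ) (A : Type*) [AddCommGroup A] :
    Function.Surjective (ModN.mkQ p : A →+ ModN A p) :=
  Submodule.mkQ_surjective _

/-- The `p`-rank is the dimension of any model of `A / pA`. -/
lemma pRank_eq_finrank {A W : Type*} [AddCommGroup A] [AddCommGroup W] [Module (ZMod p) W]
    (f : A →+ W) (hf : Function.Surjective f) (hker : ∀ a, f a = 0 → ∃ b, p • b = a) :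
    pRank p A = Module.finrank (ZMod p) W := by
  have hp : ∀ a, p • f a = 0 := fun a => by
    rw [← Nat.cast_smul_eq_nsmul (ZMod p), ZMod.natCast_self, zero_smul]
  let g : ModN A p →ₗ[ZMod p] W := ModN.liftEquiv'.symm ⟨f, hp⟩
  have hg : ∀ a, g (ModN.mkQ p a) = f a := fun a => rfl
  refine LinearEquiv.finrank_eq (LinearEquiv.ofBijective g ⟨?_, fun w => ?_⟩)
  · rw [injective_iff_map_eq_zero]
    intro x hx
    obtain ⟨a, rfl⟩ := modN_mkQ_surjective p A x
    exact modN_mk_eq_zero_iff.2 (hker a ((hg a).symm.trans hx))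
  · obtain ⟨a, rfl⟩ := hf w
    exact ⟨ModN.mkQ p a, hg a⟩

lemma pRank_congr {A B : Type*} [AddCommGroup A] [AddCommGroup B] (e : A ≃+ B) :
    pRank p A = pRank p B := by
  refine pRank_eq_finrank ((ModN.mkQ p : B →+ ModN B p).comp e.toAddMonoidHom)
    ((modN_mkQ_surjective p B).comp e.surjective) fun a ha => ?_
  obtain ⟨b, hb⟩ := modN_mk_eq_zero_iff.1 ha
  refine ⟨e.symm b, e.injective ?_⟩
  rw [map_nsmul, e.apply_symm_apply]
  exact hb

lemma pRank_le_card [Fact p.Prime] {A ι : Type*} [AddCommGroup A] [Fintype ι] (g : (ι → ℤ) →+ A)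
    (hg : Function.Surjective g) : pRank p A ≤ Fintype.card ι := by
  classical
  let v : ι → ModN A p := fun i => ModN.mkQ p (g (Pi.single i 1))
  have hspan : Submodule.span (ZMod p) (Set.range v) = ⊤ := by
    rw [eq_top_iff]
    intro x _
    obtain ⟨a, rfl⟩ := modN_mkQ_surjective p A x
    obtain ⟨y, rfl⟩ := hg a
    have hy : y = ∑ i, y i • Pi.single i (1 : ℤ) := by
      ext j
      simp [Finset.sum_apply, Pi.single_apply]
    rw [hy, map_sum, map_sum]
    refine Submodule.sum_mem _ fun i _ => ?_
    rw [map_zsmul, map_zsmul, ← Int.cast_smul_eq_zsmul (ZMod p)]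
    exact Submodule.smul_mem _ _ (Submodule.subset_span ⟨i, rfl⟩)
  have := finrank_range_le_card (R := ZMod p) v
  rwa [Set.finrank, hspan, finrank_top] at this

/-- The `p`-rank of the cokernel of an integer matrix is its corank modulo `p`. -/
lemma pRank_coker [Fact p.Prime] {ι : Type*} [Fintype ι] (M : Matrix ι ι ℤ) :
    pRank p ((ι → ℤ) ⧸ LinearMap.range M.mulVecLin) =
      (M.map (Int.cast : ℤ → ZMod p)).corank := by
  set M' := M.map (Int.cast : ℤ → ZMod p) with hM'
  have hcast : ∀ x : ι → ℤ, M'.mulVec (fun i => (x i : ZMod p)) =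
      fun i => ((M.mulVec x i : ℤ) : ZMod p) := by
    intro x
    ext i
    simp [hM', Matrix.mulVec, dotProduct]
  let c : (ι → ℤ) →+ (ι → ZMod p) :=
    { toFun := fun x i => (x i : ZMod p)
      map_zero' := by ext; simp
      map_add' := fun x y => by ext; simp }
  have hc : Function.Surjective c := fun y => by
    choose x hx using fun i => ZMod.intCast_surjective (y i)
    exact ⟨x, funext hx⟩
  let π : (ι → ZMod p) →+ ((ι → ZMod p) ⧸ LinearMap.range M'.mulVecLin) :=
    (LinearMap.range M'.mulVecLin).mkQ.toAddMonoidHom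
  have hπ : ∀ y, π y = 0 ↔ y ∈ LinearMap.range M'.mulVecLin := fun y =>
    Submodule.Quotient.mk_eq_zero _
  let f : ((ι → ℤ) ⧸ LinearMap.range M.mulVecLin) →ₗ[ℤ] _ :=
    (LinearMap.range M.mulVecLin).liftQ (π.comp c).toIntLinearMap (by
      rintro _ ⟨x, rfl⟩
      refine (hπ _).2 ⟨fun i => (x i : ZMod p), ?_⟩
      exact hcast x)
  rw [pRank_eq_finrank (p := p) f.toAddMonoidHom]
  · have h1 := Submodule.finrank_quotient_add_finrank (LinearMap.range M'.mulVecLin)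
    have h2 := M'.rank_add_corank
    rw [Matrix.rank] at h2
    rw [Module.finrank_fintype_fun_eq_card] at h1
    omega
  · intro w
    obtain ⟨y, rfl⟩ := Submodule.mkQ_surjective _ w
    obtain ⟨x, rfl⟩ := hc y
    exact ⟨Submodule.Quotient.mk x, rfl⟩
  · intro a ha
    obtain ⟨x, rfl⟩ := Submodule.mkQ_surjective _ a
    obtain ⟨y, hy⟩ := (hπ (c x)).1 ha
    obtain ⟨y, rfl⟩ := hc y
    have hxy : ∀ i, (p : ℤ) ∣ x i - M.mulVec y i := by
      intro i
      rw [← ZMod.intCast_zmod_eq_zero_iff_dvd]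
      have h1 := congrFun (hcast y) i
      have h2 := congrFun hy i
      rw [Matrix.mulVecLin_apply] at h2
      have h3 : (x i : ZMod p) = ((M.mulVec y i : ℤ) : ZMod p) := h2.symm.trans h1
      rw [Int.cast_sub, h3, sub_self]
    choose b hb using hxy
    refine ⟨Submodule.Quotient.mk b, ?_⟩
    change Submodule.Quotient.mk (p • b) = Submodule.Quotient.mk x
    rw [Submodule.Quotient.eq]
    refine ⟨-y, ?_⟩
    ext i
    have := hb i
    change M.mulVec (-y) i = p • b i - x i
    rw [Matrix.mulVec_neg, Pi.neg_apply, nsmul_eq_mul]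
    linarith

end PRank

section Corank

variable {F V : Type*} [Field F] [Fintype V]

/-- Deleting a row and the corresponding column changes the corank of a matrix by at most `1`. -/
lemma corank_submatrix_ne (A : Matrix V V F) (v : V) [Fintype {w // w ≠ v}] :
    (A.submatrix (Subtype.val : {w // w ≠ v} → V) (Subtype.val : {w // w ≠ v} → V)).corank ≤
      A.corank + 1 ∧
    A.corank ≤
      (A.submatrix (Subtype.val : {w // w ≠ v} → V) (Subtype.val : {w // w ≠ v} → V)).corank +
        1 := by
  rw [Matrix.corank, Matrix.corank]
  classical
  set A' := A.submatrix (Subtype.val : {w // w ≠ v} → V) (Subtype.val : {w // w ≠ v} → V) with hA'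
  let ext₀ : ({w // w ≠ v} → F) →ₗ[F] (V → F) :=
    { toFun := fun x w => if h : w ≠ v then x ⟨w, h⟩ else 0
      map_add' := fun x y => by ext w; by_cases h : w = v <;> simp [h]
      map_smul' := fun c x => by ext w; by_cases h : w = v <;> simp [h] }
  have hext : ∀ x (w : {w // w ≠ v}), ext₀ x w = x w := fun x w => by simp [ext₀, w.2]
  have hextv : ∀ x, ext₀ x v = 0 := fun x => by simp [ext₀]
  have hsplit : ∀ (w : V) (x : V → F), A.mulVec x w =
      A w v * x v + ∑ u : {w // w ≠ v}, A w u * x u := by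
    intro w x
    rw [Matrix.mulVec, dotProduct]
    convert Fintype.sum_eq_add_sum_subtype_ne (fun u => A w u * x u) v
  constructor
  · set K := LinearMap.ker A'.mulVecLin
    let f : K →ₗ[F] F := LinearMap.proj v ∘ₗ A.mulVecLin ∘ₗ ext₀ ∘ₗ K.subtype
    have h1 := f.finrank_range_add_finrank_ker
    have h2 : Module.finrank F (LinearMap.range f) ≤ 1 := by
      simpa using (LinearMap.range f).finrank_le
    have h3 : Module.finrank F (LinearMap.ker f) ≤
        Module.finrank F (LinearMap.ker A.mulVecLin) := by
      let g : LinearMap.ker f →ₗ[F] LinearMap.ker A.mulVecLin :=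
        LinearMap.codRestrict _ (ext₀ ∘ₗ K.subtype ∘ₗ (LinearMap.ker f).subtype) fun z => by
          rw [LinearMap.mem_ker]
          ext w
          by_cases hw : w = v
          · subst hw
            exact z.2
          · have hz : A'.mulVec z.1.1 ⟨w, hw⟩ = 0 := congrFun z.1.2 ⟨w, hw⟩
            simp only [LinearMap.comp_apply, Submodule.subtype_apply, Matrix.mulVecLin_apply,
              Pi.zero_apply]
            rw [hsplit, hextv, mul_zero, zero_add, ← hz]
            simp only [hext]
            rfl
      refine LinearMap.finrank_le_finrank_of_injective (f := g) fun z z' h => ?_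
      refine Subtype.ext (Subtype.ext (funext fun w => ?_))
      have := congrFun (congrArg Subtype.val h) w.1
      change ext₀ z.1.1 w = ext₀ z'.1.1 w at this
      rwa [hext, hext] at this
    omega
  · set K := LinearMap.ker A.mulVecLin
    let f : K →ₗ[F] F := LinearMap.proj v ∘ₗ K.subtype
    have h1 := f.finrank_range_add_finrank_ker
    have h2 : Module.finrank F (LinearMap.range f) ≤ 1 := by
      simpa using (LinearMap.range f).finrank_le
    have h3 : Module.finrank F (LinearMap.ker f) ≤
        Module.finrank F (LinearMap.ker A'.mulVecLin) := by
      let g : LinearMap.ker f →ₗ[F] LinearMap.ker A'.mulVecLin :=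
        LinearMap.codRestrict _ (LinearMap.funLeft F F Subtype.val ∘ₗ K.subtype ∘ₗ
          (LinearMap.ker f).subtype) fun z => by
          rw [LinearMap.mem_ker]
          ext w
          have hz : A.mulVec z.1.1 w = 0 := congrFun z.1.2 w
          have hzv : z.1.1 v = 0 := z.2
          rw [hsplit, hzv, mul_zero, zero_add] at hz
          exact hz
      refine LinearMap.finrank_le_finrank_of_injective (f := g) fun z z' h => ?_
      refine Subtype.ext (Subtype.ext (funext fun w => ?_))
      by_cases hw : w = v
      · subst hw
        exact (show z.1.1 w = 0 from z.2).trans (show z'.1.1 w = 0 from z'.2).symm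
      · exact congrFun (congrArg Subtype.val h) ⟨w, hw⟩
    omega

lemma reducedLaplacian_map_intCast (p : ℕ) (G : SimpleGraph V) [DecidableEq V]
    [DecidableRel G.Adj] (v : V) :
    (G.reducedLaplacian v).map (Int.cast : ℤ → ZMod p) =
      (G.lapMatrix (ZMod p)).submatrix Subtype.val Subtype.val := by
  have h : G.reducedLaplacian v = (G.lapMatrix ℤ).submatrix Subtype.val Subtype.val := by
    rw [SimpleGraph.reducedLaplacian]
    congr!
  rw [h]
  ext v w
  by_cases h : v = w
  · simp [SimpleGraph.lapMatrix, SimpleGraph.degMatrix, h]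
  · simp [SimpleGraph.lapMatrix, SimpleGraph.degMatrix, SimpleGraph.adjMatrix_apply,
      Subtype.coe_injective.ne h, apply_ite (Int.cast : ℤ → ZMod p)]

lemma corank_lapMatrix_congr {W : Type*} [Fintype W] [DecidableEq V] [DecidableEq W]
    {G : SimpleGraph V} {H : SimpleGraph W} [DecidableRel G.Adj] [DecidableRel H.Adj] (e : G ≃g H) :
    (G.lapMatrix F).corank = (H.lapMatrix F).corank := by
  have h : G.lapMatrix F = (H.lapMatrix F).submatrix e.toEquiv e.toEquiv := by
    ext v w
    simp only [SimpleGraph.lapMatrix, SimpleGraph.degMatrix, Matrix.sub_apply,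
      Matrix.diagonal_apply, SimpleGraph.adjMatrix_apply, Matrix.submatrix_apply,
      e.toEquiv.apply_eq_iff_eq]
    have h1 : H.Adj (e.toEquiv v) (e.toEquiv w) ↔ G.Adj v w := e.map_adj_iff
    have h2 : H.degree (e.toEquiv v) = G.degree v := e.degree_eq v
    simp only [h1, h2]
  have h1 := (G.lapMatrix F).rank_add_corank
  have h2 := (H.lapMatrix F).rank_add_corank
  have h3 := Matrix.rank_submatrix (H.lapMatrix F) e.toEquiv e.toEquiv
  rw [← h] at h3
  have h4 := Fintype.card_congr e.toEquiv
  omega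

open Classical in
lemma pRank_reducedLaplacianCoker {p : ℕ} [Fact p.Prime] (G : SimpleGraph V) (v : V) :
    pRank p (G.ReducedLaplacianCoker v) ≤
      (G.lapMatrix (ZMod p)).corank + 1 ∧
    (G.lapMatrix (ZMod p)).corank ≤
      pRank p (G.ReducedLaplacianCoker v) + 1 := by
  rw [pRank_coker, reducedLaplacian_map_intCast]
  exact corank_submatrix_ne _ _

/-- For a connected graph, the `p`-rank of the sandpile group is the corank of the Laplacian modulo
`p`, up to an error of at most `1`. -/
lemma pRank_sandpileGroup_of_connected {p : ℕ} [Fact p.Prime] [DecidableEq V] {G : SimpleGraph V}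
    [DecidableRel G.Adj] (hG : G.Connected) :
    pRank p G.SandpileGroup ≤
      (G.lapMatrix (ZMod p)).corank + 1 ∧
    (G.lapMatrix (ZMod p)).corank ≤
      pRank p G.SandpileGroup + 1 := by
  classical
  obtain ⟨v⟩ := hG.nonempty
  let _ : Unique G.ConnectedComponent :=
    { default := G.connectedComponentMk v
      uniq := fun C => by
        induction C using SimpleGraph.ConnectedComponent.ind with
        | _ w => exact SimpleGraph.ConnectedComponent.sound (hG.preconnected w v) }
  set C : G.ConnectedComponent := default
  have h1 : pRank p G.SandpileGroup = pRank p (C.toSimpleGraph.ReducedLaplacianCoker C.root) :=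
    pRank_congr (AddEquiv.piUnique _)
  let e : C.toSimpleGraph ≃g G :=
    { toEquiv := Equiv.subtypeUnivEquiv fun w =>
        (SimpleGraph.ConnectedComponent.mem_supp_iff C w).2 (Subsingleton.elim _ _)
      map_rel_iff' := by
        intro a b
        rfl }
  have h3 := corank_lapMatrix_congr (F := ZMod p) e
  have h4 := pRank_reducedLaplacianCoker (p := p) C.toSimpleGraph C.root
  rw [h1, ← h3]
  convert h4

lemma pRank_sandpileGroup_le {p : ℕ} [Fact p.Prime] (G : SimpleGraph V) :
    pRank p G.SandpileGroup ≤ Fintype.card V := by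
  classical
  let ι := Σ C : G.ConnectedComponent, {w : C // w ≠ C.root}
  let g : (ι → ℤ) →+ G.SandpileGroup :=
    { toFun := fun x C => Submodule.Quotient.mk fun w => x ⟨C, w⟩
      map_zero' := rfl
      map_add' := fun _ _ => rfl }
  have hg : Function.Surjective g := by
    intro y
    choose x hx using fun C => Submodule.mkQ_surjective _ (y C)
    exact ⟨fun i => x i.1 i.2, funext hx⟩
  refine (pRank_le_card g hg).trans ?_
  refine Fintype.card_le_of_injective (fun i : ι => (i.2.1.1 : V)) ?_
  rintro ⟨C, ⟨w, hw⟩, h⟩ ⟨C', ⟨w', hw'⟩, h'⟩ heq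
  change w = w' at heq
  subst heq
  have : C = C' := ((SimpleGraph.ConnectedComponent.mem_supp_iff C w).1 hw).symm.trans
    ((SimpleGraph.ConnectedComponent.mem_supp_iff C' w).1 hw')
  subst this
  rfl

end Corank

/-! ### Laplacians of bipartite graphs -/

section Bipartite

variable {F : Type*} [Field F] {n m : ℕ}

/-- The bipartite graph whose biadjacency matrix has the columns `B`. -/
def columnGraph (B : Fin m → Fin n → Bool) : SimpleGraph (Fin n ⊕ Fin m) :=
  bipartiteGraph fun x => B x.2 x.1

lemma columnGraph_adj_inl_inr (B : Fin m → Fin n → Bool) (l : Fin n) (r : Fin m) :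
    (columnGraph B).Adj (Sum.inl l) (Sum.inr r) ↔ B r l = true := by
  simp [columnGraph, bipartiteGraph]

lemma columnGraph_adj_inr_inl (B : Fin m → Fin n → Bool) (l : Fin n) (r : Fin m) :
    (columnGraph B).Adj (Sum.inr r) (Sum.inl l) ↔ B r l = true := by
  rw [SimpleGraph.adj_comm, columnGraph_adj_inl_inr]

lemma columnGraph_not_adj_inl_inl (B : Fin m → Fin n → Bool) (l l' : Fin n) :
    ¬ (columnGraph B).Adj (Sum.inl l) (Sum.inl l') := by
  simp [columnGraph, bipartiteGraph]

lemma columnGraph_not_adj_inr_inr (B : Fin m → Fin n → Bool) (r r' : Fin m) :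
    ¬ (columnGraph B).Adj (Sum.inr r) (Sum.inr r') := by
  simp [columnGraph, bipartiteGraph]

lemma lapMatrix_mulVec_eq_sum {V : Type*} [Fintype V] [DecidableEq V] (G : SimpleGraph V)
    [DecidableRel G.Adj] (x : V → F) (v : V) :
    (G.lapMatrix F).mulVec x v = ∑ w, if G.Adj v w then x v - x w else 0 := by
  rw [SimpleGraph.lapMatrix_mulVec_apply, SimpleGraph.degree_eq_sum_if_adj, Finset.sum_mul,
    SimpleGraph.neighborFinset_eq_filter, Finset.sum_filter, ← Finset.sum_sub_distrib]
  refine Finset.sum_congr rfl fun w _ => ?_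
  split_ifs <;> simp

lemma corank_lapMatrix_columnGraph (B : Fin m → Fin n → Bool)
    [DecidableRel (columnGraph B).Adj] :
    ((columnGraph B).lapMatrix F).corank =
      bipartiteCorank (fun l => ∑ i, bit F (B i l)) (bitColumns F B) := by
  let φ := LinearEquiv.sumArrowLequivProdArrow (Fin n) (Fin m) F F
  have hφ : ∀ x, bipartiteLaplacian (fun l => ∑ i, bit F (B i l)) (bitColumns F B) (φ x) =
      φ (((columnGraph B).lapMatrix F).mulVec x) := by
    intro x
    ext j
    · change _ = ((columnGraph B).lapMatrix F).mulVec x (Sum.inl j)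
      rw [lapMatrix_mulVec_eq_sum, Fintype.sum_sum_type]
      simp only [columnGraph_not_adj_inl_inl, columnGraph_adj_inl_inr, if_false,
        Finset.sum_const_zero, zero_add]
      change (∑ i, bit F (B i j)) * x (Sum.inl j) - ∑ i, bit F (B i j) * x (Sum.inr i) = _
      rw [Finset.sum_mul, ← Finset.sum_sub_distrib]
      refine Finset.sum_congr rfl fun i _ => ?_
      cases B i j <;> simp [bit]
    · change _ = ((columnGraph B).lapMatrix F).mulVec x (Sum.inr j)
      rw [lapMatrix_mulVec_eq_sum, Fintype.sum_sum_type]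
      simp only [columnGraph_not_adj_inr_inr, columnGraph_adj_inr_inl, if_false,
        Finset.sum_const_zero, add_zero]
      change ∑ l, bit F (B j l) * (x (Sum.inr j) - x (Sum.inl l)) = _
      refine Finset.sum_congr rfl fun i _ => ?_
      cases B j i <;> simp [bit]
  rw [bipartiteCorank, Matrix.corank]
  have : LinearMap.ker ((columnGraph B).lapMatrix F).mulVecLin =
      (LinearMap.ker (bipartiteLaplacian (fun l => ∑ i, bit F (B i l))
        (bitColumns F B))).comap φ.toLinearMap := by
    ext x
    simp only [Submodule.mem_comap, LinearMap.mem_ker, LinearEquiv.coe_coe, hφ,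
      Matrix.mulVecLin_apply, map_eq_zero_iff φ φ.injective]
  rw [this]
  exact (φ.submoduleMap _).finrank_eq.trans (by
    rw [Submodule.map_comap_eq_of_surjective φ.surjective])

/-- A bipartite graph is connected if the vertices on the left have common neighbours, and those on
the right are not isolated. -/
lemma columnGraph_connected (B : Fin m → Fin n → Bool) (hn : 0 < n)
    (h1 : ∀ l l', l ≠ l' → ∃ r, B r l = true ∧ B r l' = true) (h2 : ∀ r, ∃ l, B r l = true) :
    (columnGraph B).Connected := by
  have hl : ∀ l, (columnGraph B).Reachable (Sum.inl l) (Sum.inl ⟨0, hn⟩) := by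
    intro l
    by_cases h : l = ⟨0, hn⟩
    · rw [h]
    · obtain ⟨r, hr, hr'⟩ := h1 l _ h
      exact ((columnGraph_adj_inl_inr B l r).2 hr).reachable.trans
        ((columnGraph_adj_inr_inl B _ r).2 hr').reachable
  have hv : ∀ v, (columnGraph B).Reachable v (Sum.inl ⟨0, hn⟩) := by
    rintro (l | r)
    · exact hl l
    · obtain ⟨l, hr⟩ := h2 r
      exact ((columnGraph_adj_inr_inl B l r).2 hr).reachable.trans (hl l)
  exact { preconnected := fun v w => (hv v).trans (hv w).symm
          nonempty := ⟨Sum.inl ⟨0, hn⟩⟩ }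

end Bipartite

/-! ### The expected `p`-rank and the expected corank -/

section Expectation

lemma sum_pi_prod {ι κ : Type*} [Fintype ι] [DecidableEq ι] [Fintype κ] (f : ι → κ → ℝ) :
    ∑ x : ι → κ, ∏ i, f i (x i) = ∏ i, ∑ j, f i j := by
  rw [Finset.prod_univ_sum, Fintype.piFinset_univ]

/-- The probability that the random biadjacency matrix has the columns `B`. -/
def columnsWeight (q : ℝ) {n m : ℕ} (B : Fin m → Fin n → Bool) : ℝ :=
  ∏ i, ∏ l, bitWeight q (B i l)

variable {n m : ℕ} {q : ℝ}

lemma columnsWeight_nonneg (hq : q ∈ Set.Icc (0 : ℝ) 1) (B : Fin m → Fin n → Bool) :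
    0 ≤ columnsWeight q B :=
  Finset.prod_nonneg fun _ _ => Finset.prod_nonneg fun _ _ => bitWeight_nonneg hq _

lemma sum_prod_bitWeight (q : ℝ) (n : ℕ) : ∑ b : Fin n → Bool, ∏ l, bitWeight q (b l) = 1 := by
  rw [sum_pi_prod fun _ => bitWeight q]
  simp only [sum_bitWeight, Finset.prod_const_one]

lemma sum_columnsWeight (q : ℝ) (n m : ℕ) :
    ∑ B : Fin m → Fin n → Bool, columnsWeight q B = 1 := by
  simp only [columnsWeight]
  rw [sum_pi_prod fun _ (b : Fin n → Bool) => ∏ l, bitWeight q (b l)]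
  simp only [sum_prod_bitWeight, Finset.prod_const_one]

lemma measurable_of_simpleGraph {V : Type*} [Finite V] (f : SimpleGraph V → ℝ) :
    Measurable f := by
  have : MeasurableSingletonClass (SimpleGraph V) := by
    refine ⟨fun G => ?_⟩
    rw [← Set.preimage_image_eq {G} SimpleGraph.edgeSet_injective, Set.image_singleton]
    exact SimpleGraph.measurable_edgeSet (measurableSet_singleton _)
  exact measurable_of_finite f

lemma expectedPRank_eq_sum (p n : ℕ) (α : ℝ) (q : unitInterval) :
    expectedPRank p n α q = ∑ B : Fin ⌊α * n⌋₊ → Fin n → Bool,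
      columnsWeight q B * pRank p (columnGraph B).SandpileGroup := by
  rw [expectedPRank, randomBipartiteGraph, integral_map (measurable_of_finite _).aemeasurable
    (measurable_of_simpleGraph _).aestronglyMeasurable, integral_fintype (hf := .of_finite)]
  refine Fintype.sum_equiv ((Equiv.curry _ _ _).trans (Equiv.piComm _)) _ _ fun e => ?_
  rw [smul_eq_mul]
  congr 1
  rw [measureReal_def, Measure.pi_singleton, ENNReal.toReal_prod, Fintype.prod_prod_type,
    Finset.prod_comm, columnsWeight]
  refine Finset.prod_congr rfl fun r _ => Finset.prod_congr rfl fun l _ => ?_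
  rw [← measureReal_def, bernoulliMeasure_real_apply q (measurableSet_singleton _)]
  change _ = bitWeight q (e (l, r))
  cases e (l, r) <;> simp [bitWeight]

open Classical in
lemma sum_bit_pair (q : ℝ) {l l' : Fin n} (h : l ≠ l') :
    ∑ b : Fin n → Bool, (if b l = true ∧ b l' = true then 0 else ∏ i, bitWeight q (b i)) =
      1 - q ^ 2 := by
  have h1 : ∑ b : Fin n → Bool, ∏ i, (if i ∈ ({l, l'} : Finset (Fin n)) then
      (if b i = true then q else 0) else bitWeight q (b i)) = q ^ 2 := by
    rw [sum_pi_prod fun i (β : Bool) => if i ∈ ({l, l'} : Finset (Fin n)) then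
      (if β = true then q else 0) else bitWeight q β]
    have : ∀ i, ∑ β : Bool, (if i ∈ ({l, l'} : Finset (Fin n)) then
        (if β = true then q else 0) else bitWeight q β) =
        if i ∈ ({l, l'} : Finset (Fin n)) then q else 1 := by
      intro i
      split_ifs
      · simp
      · exact sum_bitWeight q
    simp only [this]
    rw [Finset.prod_ite_mem, Finset.univ_inter, Finset.prod_const, Finset.card_pair h]
  rw [← h1, ← sum_prod_bitWeight q n, ← Finset.sum_sub_distrib]
  refine Finset.sum_congr rfl fun b _ => ?_
  by_cases hb : b l = true ∧ b l' = true
  · rw [if_pos hb, eq_comm, sub_eq_zero]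
    refine Finset.prod_congr rfl fun i _ => ?_
    by_cases hi : i ∈ ({l, l'} : Finset (Fin n))
    · have : b i = true := by
        rcases Finset.mem_insert.1 hi with rfl | hi
        · exact hb.1
        · rw [Finset.mem_singleton.1 hi]; exact hb.2
      rw [if_pos hi, if_pos this, this]
      simp [bitWeight]
    · rw [if_neg hi]
  · rw [if_neg hb, eq_comm, sub_eq_self]
    rw [not_and_or] at hb
    rcases hb with hb | hb
    · exact Finset.prod_eq_zero (Finset.mem_univ l) (by simp [hb])
    · exact Finset.prod_eq_zero (Finset.mem_univ l') (by simp [hb])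

open Classical in
/-- The random bipartite graph is disconnected with exponentially small probability. -/
lemma sum_columnsWeight_not_connected_le (hq : q ∈ Set.Icc (0 : ℝ) 1) (hn : 0 < n) :
    ∑ B : Fin m → Fin n → Bool, (if (columnGraph B).Connected then 0 else columnsWeight q B) ≤
      n ^ 2 * (1 - q ^ 2) ^ m + m * (1 - q) ^ n := by
  have h1 : ∀ x : Fin n × Fin n, x.1 ≠ x.2 → ∑ B : Fin m → Fin n → Bool,
      (if ∀ r, ¬ (B r x.1 = true ∧ B r x.2 = true) then columnsWeight q B else 0) =
        (1 - q ^ 2) ^ m := by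
    intro x hx
    have := sum_pi_prod fun (_ : Fin m) (b : Fin n → Bool) =>
      if b x.1 = true ∧ b x.2 = true then 0 else ∏ i, bitWeight q (b i)
    simp only [sum_bit_pair q hx, Finset.prod_const, Finset.card_univ, Fintype.card_fin] at this
    rw [← this]
    refine Finset.sum_congr rfl fun B _ => ?_
    split_ifs with h
    · exact Finset.prod_congr rfl fun r _ => (if_neg (h r)).symm
    · push Not at h
      obtain ⟨r, hr⟩ := h
      refine Eq.symm (Finset.prod_eq_zero (Finset.mem_univ r) ?_)
      exact if_pos hr
  have h2 : ∀ r : Fin m, ∑ B : Fin m → Fin n → Bool,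
      (if ∀ l, B r l = false then columnsWeight q B else 0) = (1 - q) ^ n := by
    intro r
    have hcol : ∀ i, ∑ b : Fin n → Bool, (if i = r ∧ ¬ ∀ l, b l = false then 0 else
        ∏ l, bitWeight q (b l)) = if i = r then (1 - q) ^ n else 1 := by
      intro i
      by_cases hi : i = r
      · rw [if_pos hi, Finset.sum_eq_single fun _ => false]
        · simp [bitWeight]
        · intro b _ hb
          refine if_pos ⟨hi, fun h => hb (funext h)⟩
        · simp
      · simp only [hi, false_and, if_false, sum_prod_bitWeight]
    have := sum_pi_prod fun (i : Fin m) (b : Fin n → Bool) =>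
      if i = r ∧ ¬ ∀ l, b l = false then 0 else ∏ l, bitWeight q (b l)
    simp only [hcol, Finset.prod_ite_eq', Finset.mem_univ, if_true] at this
    rw [← this]
    refine Finset.sum_congr rfl fun B _ => ?_
    split_ifs with h
    · exact Finset.prod_congr rfl fun i _ => (if_neg fun hi => hi.2 (hi.1 ▸ h)).symm
    · refine Eq.symm (Finset.prod_eq_zero (Finset.mem_univ r) ?_)
      exact if_pos ⟨rfl, h⟩
  have hq2 : 0 ≤ 1 - q ^ 2 := by nlinarith [hq.1, hq.2]
  calc _ ≤ ∑ B : Fin m → Fin n → Bool, (∑ x ∈ (Finset.univ : Finset (Fin n)).offDiag,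
          (if ∀ r, ¬ (B r x.1 = true ∧ B r x.2 = true) then columnsWeight q B else 0) +
          ∑ r, (if ∀ l, B r l = false then columnsWeight q B else 0)) := by
        refine Finset.sum_le_sum fun B _ => ?_
        have hw := columnsWeight_nonneg hq B
        have hx : ∀ x ∈ (Finset.univ : Finset (Fin n)).offDiag, 0 ≤
            (if ∀ r, ¬ (B r x.1 = true ∧ B r x.2 = true) then columnsWeight q B else 0) := by
          intro x _
          split_ifs
          · exact hw
          · exact le_rfl
        have hr : ∀ r ∈ (Finset.univ : Finset (Fin m)), 0 ≤
            (if ∀ l, B r l = false then columnsWeight q B else 0) := by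
          intro r _
          split_ifs
          · exact hw
          · exact le_rfl
        by_cases hc : (columnGraph B).Connected
        · rw [if_pos hc]
          exact add_nonneg (Finset.sum_nonneg hx) (Finset.sum_nonneg hr)
        · rw [if_neg hc]
          by_cases h : ∀ l l', l ≠ l' → ∃ r, B r l = true ∧ B r l' = true
          · have : ¬ ∀ r, ∃ l, B r l = true := fun h' => hc (columnGraph_connected B hn h h')
            push Not at this
            obtain ⟨r, hr0⟩ := this
            refine le_add_of_nonneg_of_le (Finset.sum_nonneg hx) ?_
            refine le_trans ?_ (Finset.single_le_sum hr (Finset.mem_univ r))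
            rw [if_pos fun l => by simpa using hr0 l]
          · push Not at h
            obtain ⟨l, l', hne, h⟩ := h
            refine le_add_of_le_of_nonneg ?_ (Finset.sum_nonneg hr)
            refine le_trans ?_ (Finset.single_le_sum hx (a := (l, l'))
              (Finset.mem_offDiag.2 ⟨Finset.mem_univ l, Finset.mem_univ l', hne⟩))
            rw [if_pos fun r hr => h r hr.1 hr.2]
    _ = ∑ x ∈ (Finset.univ : Finset (Fin n)).offDiag, (1 - q ^ 2) ^ m +
          ∑ _r : Fin m, (1 - q) ^ n := by
        rw [Finset.sum_add_distrib, Finset.sum_comm,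
          Finset.sum_comm (s := (Finset.univ : Finset (Fin m → Fin n → Bool)))]
        congr 1
        · exact Finset.sum_congr rfl fun x hx => h1 x (Finset.mem_offDiag.1 hx).2.2
        · exact Finset.sum_congr rfl fun r _ => h2 r
    _ ≤ _ := by
        rw [Finset.sum_const, Finset.sum_const, nsmul_eq_mul, nsmul_eq_mul, Finset.card_univ,
          Fintype.card_fin]
        gcongr
        rw [Finset.offDiag_card, Finset.card_univ, Fintype.card_fin, sq]
        exact_mod_cast Nat.sub_le _ _

open Classical in
/-- The expected `p`-rank of the sandpile group and the expected corank of the Laplacian modulo `p`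
differ by a bounded amount. -/
lemma abs_sum_pRank_sub_sum_corank_le {p : ℕ} [Fact p.Prime] (hq : q ∈ Set.Icc (0 : ℝ) 1)
    (hn : 0 < n) :
    |∑ B : Fin m → Fin n → Bool, columnsWeight q B * pRank p (columnGraph B).SandpileGroup -
      ∑ B : Fin m → Fin n → Bool, columnsWeight q B *
        bipartiteCorank (fun l => ∑ i, bit (ZMod p) (B i l)) (bitColumns (ZMod p) B)| ≤
      1 + (n + m) * (n ^ 2 * (1 - q ^ 2) ^ m + m * (1 - q) ^ n) := by
  rw [← Finset.sum_sub_distrib]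
  refine (Finset.abs_sum_le_sum_abs _ _).trans ?_
  have hpt : ∀ B : Fin m → Fin n → Bool,
      |columnsWeight q B * pRank p (columnGraph B).SandpileGroup - columnsWeight q B *
        bipartiteCorank (fun l => ∑ i, bit (ZMod p) (B i l)) (bitColumns (ZMod p) B)| ≤
      columnsWeight q B +
        (n + m) * (if (columnGraph B).Connected then 0 else columnsWeight q B) := by
    intro B
    have hw := columnsWeight_nonneg hq B
    rw [← mul_sub, abs_mul, abs_of_nonneg hw]
    split_ifs with h
    · have h1 := pRank_sandpileGroup_of_connected (p := p) h
      rw [corank_lapMatrix_columnGraph] at h1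
      rw [mul_zero, add_zero]
      refine mul_le_of_le_one_right hw ?_
      have h2 : (pRank p (columnGraph B).SandpileGroup : ℝ) ≤ (_ : ℕ) := Nat.cast_le.2 h1.1
      have h3 : ((_ : ℕ) : ℝ) ≤ (pRank p (columnGraph B).SandpileGroup + 1 : ℕ) :=
        Nat.cast_le.2 h1.2
      push_cast at h2 h3
      rw [abs_le]
      constructor <;> linarith
    · have h1 := pRank_sandpileGroup_le (p := p) (columnGraph B)
      have h2 := bipartiteCorank_le (fun l => ∑ i, bit (ZMod p) (B i l)) (bitColumns (ZMod p) B)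
      rw [Fintype.card_sum, Fintype.card_fin, Fintype.card_fin] at h1
      rw [Fintype.card_fin] at h2
      have h1' : (pRank p (columnGraph B).SandpileGroup : ℝ) ≤ n + m := by exact_mod_cast h1
      have h2' : (bipartiteCorank (fun l => ∑ i, bit (ZMod p) (B i l))
        (bitColumns (ZMod p) B) : ℝ) ≤ n + m := by exact_mod_cast h2
      rw [mul_comm]
      refine le_add_of_nonneg_of_le hw (mul_le_mul_of_nonneg_right ?_ hw)
      have h3 : (0 : ℝ) ≤ pRank p (columnGraph B).SandpileGroup := Nat.cast_nonneg _
      have h4 : (0 : ℝ) ≤ bipartiteCorank (fun l => ∑ i, bit (ZMod p) (B i l))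
        (bitColumns (ZMod p) B) := Nat.cast_nonneg _
      rw [abs_le]
      constructor <;> linarith
  refine (Finset.sum_le_sum fun B _ => hpt B).trans ?_
  rw [Finset.sum_add_distrib, ← Finset.mul_sum, sum_columnsWeight]
  gcongr
  exact sum_columnsWeight_not_connected_le hq hn

end Expectation

/-! ### Equidistribution of the degrees modulo `p` -/

section Fourier

variable {p : ℕ} [Fact p.Prime] {q : ℝ}

lemma sum_bitSumLaw_mul_addChar (q : ℝ) (ψ : AddChar (ZMod p) ℂ) (N : ℕ) :
    ∑ e, (bitSumLaw (ZMod p) q N e : ℂ) * ψ e = (1 - q + q * ψ 1) ^ N := by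
  induction N with
  | zero =>
    rw [Finset.sum_eq_single 0]
    · simp [bitSumLaw]
    · intro e _ he
      simp [bitSumLaw, he]
    · simp
  | succ N ih =>
    have hβ : ∀ β : Bool, ∑ e, (bitSumLaw (ZMod p) q N (e - bit (ZMod p) β) : ℂ) * ψ e =
        ψ (bit (ZMod p) β) * (1 - q + q * ψ 1) ^ N := by
      intro β
      rw [← ih, Finset.mul_sum, ← Equiv.sum_comp (Equiv.addRight (bit (ZMod p) β))]
      refine Finset.sum_congr rfl fun e _ => ?_
      simp only [Equiv.coe_addRight, add_sub_cancel_right, AddChar.map_add_eq_mul]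
      ring
    simp only [bitSumLaw, Complex.ofReal_sum, Complex.ofReal_mul, Finset.sum_mul, mul_assoc]
    rw [Finset.sum_comm]
    simp only [← Finset.mul_sum, hβ]
    simp only [Fintype.sum_bool, bitWeight, bit, if_true, Bool.false_eq_true, if_false,
      AddChar.map_zero_eq_one, Complex.ofReal_sub, Complex.ofReal_one]
    ring

/-- The number of edges at a vertex is equidistributed modulo `p`, up to an exponentially small
error. -/
lemma exists_abs_bitSumLaw_sub_le (hq : q ∈ Set.Ioo (0 : ℝ) 1) :
    ∃ θ : ℝ, 0 ≤ θ ∧ θ < 1 ∧ ∀ (N : ℕ) (e : ZMod p),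
      |bitSumLaw (ZMod p) q N e - 1 / p| ≤ θ ^ N := by
  set ψ : AddChar (ZMod p) ℂ := ZMod.stdAddChar with hψ
  have hprim : ψ.IsPrimitive := ZMod.isPrimitive_stdAddChar p
  have hp0 : (0 : ℝ) < p := by exact_mod_cast (Fact.out : p.Prime).pos
  let φ : ZMod p → ℂ := fun t => 1 - q + q * ψ t
  have hφ : ∀ t, t ≠ 0 → ‖φ t‖ < 1 := by
    intro t ht
    have hne : (1 : ℂ) ≠ ψ t := by
      intro h
      refine ht (ZMod.injective_stdAddChar ?_)
      rw [AddChar.map_zero_eq_one, ← hψ, h]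
    have := norm_combo_lt_of_ne (x := (1 : ℂ)) (y := ψ t) (r := 1) (by simp)
      (by rw [AddChar.norm_apply]) hne (a := 1 - q) (b := q) (by linarith [hq.2]) hq.1 (by ring)
    simpa [φ] using this
  obtain ⟨t₀, ht₀, hmax⟩ := Finset.exists_max_image
    ((Finset.univ : Finset (ZMod p)).filter (· ≠ 0)) (fun t => ‖φ t‖)
    ⟨1, by simp⟩
  have ht₀' : t₀ ≠ 0 := (Finset.mem_filter.1 ht₀).2
  refine ⟨‖φ t₀‖, norm_nonneg _, hφ _ ht₀', fun N e => ?_⟩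
  have hinv : (p : ℂ) * bitSumLaw (ZMod p) q N e = ∑ t, ψ (-(t * e)) * φ t ^ N := by
    have h1 : ∀ t, ψ (-(t * e)) * φ t ^ N =
        ∑ f, (bitSumLaw (ZMod p) q N f : ℂ) * ψ (t * (f - e)) := by
      intro t
      have := sum_bitSumLaw_mul_addChar q (AddChar.mulShift ψ t) N
      simp only [AddChar.mulShift_apply, mul_one] at this
      rw [← this, Finset.mul_sum]
      refine Finset.sum_congr rfl fun f _ => ?_
      rw [mul_sub, sub_eq_add_neg, AddChar.map_add_eq_mul]
      ring
    simp only [h1]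
    rw [Finset.sum_comm]
    simp only [← Finset.mul_sum, AddChar.sum_mulShift _ hprim]
    rw [Finset.sum_eq_single e]
    · simp [mul_comm]
    · intro f _ hf
      simp [sub_eq_zero, hf]
    · simp
  have hsum : (p : ℂ) * bitSumLaw (ZMod p) q N e - 1 =
      ∑ t ∈ (Finset.univ : Finset (ZMod p)).filter (· ≠ 0), ψ (-(t * e)) * φ t ^ N := by
    rw [hinv, Finset.filter_ne', ← Finset.add_sum_erase _ _ (Finset.mem_univ (0 : ZMod p))]
    simp [φ]
  have hnorm : ‖(p : ℂ) * bitSumLaw (ZMod p) q N e - 1‖ ≤ p * ‖φ t₀‖ ^ N := by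
    rw [hsum]
    refine (norm_sum_le_of_le _ fun t ht => ?_).trans (b := ∑ t ∈
      (Finset.univ : Finset (ZMod p)).filter (· ≠ 0), ‖φ t₀‖ ^ N) ?_
    · rw [norm_mul, AddChar.norm_apply, one_mul, norm_pow]
      exact pow_le_pow_left₀ (norm_nonneg _) (hmax t ht) N
    · rw [Finset.sum_const, nsmul_eq_mul]
      gcongr
      exact (Finset.card_filter_le _ _).trans (by rw [Finset.card_univ, ZMod.card])
  have hreal : ‖(p : ℂ) * bitSumLaw (ZMod p) q N e - 1‖ =
      p * |bitSumLaw (ZMod p) q N e - 1 / p| := by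
    have : (p : ℂ) * bitSumLaw (ZMod p) q N e - 1 =
        ((p * (bitSumLaw (ZMod p) q N e - 1 / p) : ℝ) : ℂ) := by
      rw [mul_sub, mul_one_div_cancel hp0.ne']
      push_cast
      ring
    rw [this, Complex.norm_real, Real.norm_eq_abs, abs_mul, abs_of_pos hp0]
  rw [hreal] at hnorm
  exact le_of_mul_le_mul_left hnorm hp0

/-- As long as sufficiently many columns are to come, both values of a bit keep a conditional
probability that is bounded below, given the residue of the row sum. -/
lemma exists_bitWeight_mul_bitSumLaw_le (hq : q ∈ Set.Ioo (0 : ℝ) 1) :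
    ∃ ρ : ℝ, 0 < ρ ∧ ρ < 1 ∧ ∃ K : ℕ, ∀ N, K ≤ N → ∀ (e : ZMod p) (β : Bool),
      bitWeight q β * bitSumLaw (ZMod p) q N (e - bit (ZMod p) β) ≤
        ρ * bitSumLaw (ZMod p) q (N + 1) e := by
  obtain ⟨θ, hθ0, hθ1, hθ⟩ := exists_abs_bitSumLaw_sub_le (p := p) hq
  have hqI : q ∈ Set.Icc (0 : ℝ) 1 := Set.Ioo_subset_Icc_self hq
  have hp1 : (1 : ℝ) < p := by exact_mod_cast (Fact.out : p.Prime).one_lt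
  have hp0 : (0 : ℝ) < p := by linarith
  set c : ℝ := 1 / (2 * p) with hc
  have hc0 : 0 < c := by positivity
  have hc1 : c < 1 := by
    rw [hc, div_lt_one (by positivity)]
    linarith
  obtain ⟨K, hK⟩ := exists_pow_lt_of_lt_one hc0 hθ1
  have hlow : ∀ N, K ≤ N → ∀ e : ZMod p, c ≤ bitSumLaw (ZMod p) q N e := by
    intro N hN e
    have h1 := (abs_le.1 (hθ N e)).1
    have h2 : θ ^ N ≤ θ ^ K := pow_le_pow_of_le_one hθ0 hθ1.le hN
    have h3 : 1 / (p : ℝ) = c + c := by rw [hc]; field_simp; norm_num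
    linarith
  set δ := min q (1 - q) with hδ
  have hδ0 : 0 < δ := lt_min hq.1 (by linarith [hq.2])
  have hδ1 : δ < 1 := (min_le_left _ _).trans_lt hq.2
  have hδw : ∀ β, δ ≤ bitWeight q β := fun β => by
    cases β
    · exact min_le_right _ _
    · exact min_le_left _ _
  refine ⟨1 - δ * c, ?_, ?_, K, fun N hN e β => ?_⟩
  · nlinarith
  · have := mul_pos hδ0 hc0
    linarith
  · have hle1 : bitSumLaw (ZMod p) q (N + 1) e ≤ 1 := by
      rw [← sum_bitSumLaw (F := ZMod p) q (N + 1)]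
      exact Finset.single_le_sum (fun f _ => bitSumLaw_nonneg hqI _ f) (Finset.mem_univ e)
    have hge0 := bitSumLaw_nonneg hqI (N + 1) e
    have hstep : bitSumLaw (ZMod p) q (N + 1) e =
        bitWeight q β * bitSumLaw (ZMod p) q N (e - bit (ZMod p) β) +
        bitWeight q (!β) * bitSumLaw (ZMod p) q N (e - bit (ZMod p) (!β)) := by
      rw [bitSumLaw, Fintype.sum_bool]
      cases β
      · rw [add_comm]; rfl
      · rfl
    have hother : δ * c ≤ bitWeight q (!β) * bitSumLaw (ZMod p) q N (e - bit (ZMod p) (!β)) :=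
      mul_le_mul (hδw _) (hlow N hN _) hc0.le (hδ0.le.trans (hδw _))
    nlinarith [mul_pos hδ0 hc0]

end Fourier

/-! ### The expected excess of a binomial random variable over a threshold -/

section Binomial

/-- The probability that a binomial random variable with parameters `n` and `a` equals `j`. -/
def binomialWeight (n : ℕ) (a : ℝ) (j : ℕ) : ℝ := n.choose j * a ^ j * (1 - a) ^ (n - j)

/-- The expectation of `max (X - m) 0` for a binomial random variable `X` with parameters `n` and
`a`. -/
def binomialExcess (n m : ℕ) (a : ℝ) : ℝ :=
  ∑ j ∈ Finset.range (n + 1), binomialWeight n a j * ((j - m : ℕ) : ℝ)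

open Classical in
/-- The number of zeros among `n` independent elements with the same law is binomial. -/
lemma sum_prod_mul_card_zeros {F : Type*} [Fintype F] [Zero F] {P : F → ℝ} (hP : ∑ e, P e = 1)
    (n : ℕ) (g : ℕ → ℝ) :
    ∑ d : Fin n → F, (∏ l, P (d l)) * g (Finset.univ.filter fun l => d l = 0).card =
      ∑ j ∈ Finset.range (n + 1), binomialWeight n (P 0) j * g j := by
  have hS : ∀ S : Finset (Fin n),
      ∑ d : Fin n → F, (if (Finset.univ.filter fun l => d l = 0) = S then ∏ l, P (d l) else 0) =
        P 0 ^ S.card * (1 - P 0) ^ (n - S.card) := by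
    intro S
    have h1 : ∀ d : Fin n → F,
        (if (Finset.univ.filter fun l => d l = 0) = S then ∏ l, P (d l) else 0) =
          ∏ l, (if d l = 0 ↔ l ∈ S then P (d l) else 0) := by
      intro d
      split_ifs with h
      · refine Finset.prod_congr rfl fun l _ => (if_pos ?_).symm
        rw [← h]
        simp
      · have : ∃ l, ¬ (d l = 0 ↔ l ∈ S) := by
          by_contra! h'
          exact h (Finset.ext fun l => by simpa using h' l)
        obtain ⟨l, hl⟩ := this
        refine Eq.symm (Finset.prod_eq_zero (Finset.mem_univ l) ?_)
        exact if_neg hl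
    simp only [h1]
    rw [sum_pi_prod fun l (e : F) => if e = 0 ↔ l ∈ S then P e else 0]
    have h2 : ∀ l, ∑ e, (if e = 0 ↔ l ∈ S then P e else 0) = if l ∈ S then P 0 else 1 - P 0 := by
      intro l
      by_cases hl : l ∈ S
      · simp only [hl, iff_true, if_true]
        rw [Finset.sum_eq_single 0 (fun _ _ h => if_neg h) (by simp), if_pos rfl]
      · simp only [hl, iff_false, if_false]
        rw [← hP, ← Finset.add_sum_erase _ _ (Finset.mem_univ (0 : F)),
          ← Finset.add_sum_erase _ P (Finset.mem_univ (0 : F))]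
        simp only [not_true, if_false, zero_add, add_sub_cancel_left]
        exact Finset.sum_congr rfl fun e he => if_pos (Finset.ne_of_mem_erase he)
    simp only [h2]
    rw [Finset.prod_ite, Finset.prod_const, Finset.prod_const, Finset.filter_mem_eq_inter,
      Finset.univ_inter, Finset.filter_notMem_eq_sdiff, ← Finset.compl_eq_univ_sdiff,
      Finset.card_compl, Fintype.card_fin]
  have h3 : ∀ d : Fin n → F,
      (∏ l, P (d l)) * g (Finset.univ.filter fun l => d l = 0).card =
      ∑ S : Finset (Fin n), (if (Finset.univ.filter fun l => d l = 0) = S then ∏ l, P (d l)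
        else 0) * g S.card := by
    intro d
    simp [ite_mul]
  simp only [h3]
  rw [Finset.sum_comm]
  simp only [← Finset.sum_mul, hS]
  rw [← Finset.powerset_univ, Finset.sum_powerset_apply_card
    (fun j => P 0 ^ j * (1 - P 0) ^ (n - j) * g j), Finset.card_univ, Fintype.card_fin]
  refine Finset.sum_congr rfl fun j _ => ?_
  rw [nsmul_eq_mul, binomialWeight]
  ring

lemma binomialWeight_eq_eval (n j : ℕ) (a : ℝ) :
    (bernsteinPolynomial ℝ n j).eval a = binomialWeight n a j := by
  simp [bernsteinPolynomial, binomialWeight]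

lemma binomialWeight_nonneg {a : ℝ} (ha : a ∈ Set.Icc (0 : ℝ) 1) (n j : ℕ) :
    0 ≤ binomialWeight n a j := by
  have h1 : 0 ≤ 1 - a := sub_nonneg.2 ha.2
  have h2 := ha.1
  rw [binomialWeight]
  positivity

lemma sum_binomialWeight (n : ℕ) (a : ℝ) :
    ∑ j ∈ Finset.range (n + 1), binomialWeight n a j = 1 := by
  have := congrArg (Polynomial.eval a) (bernsteinPolynomial.sum ℝ n)
  simpa [Polynomial.eval_finsetSum, binomialWeight_eq_eval] using this

lemma sum_binomialWeight_mul (n : ℕ) (a : ℝ) :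
    ∑ j ∈ Finset.range (n + 1), binomialWeight n a j * j = n * a := by
  have := congrArg (Polynomial.eval a) (bernsteinPolynomial.sum_smul ℝ n)
  simpa [Polynomial.eval_finsetSum, binomialWeight_eq_eval, mul_comm] using this

lemma sum_binomialWeight_mul_sq (n : ℕ) (a : ℝ) :
    ∑ j ∈ Finset.range (n + 1), binomialWeight n a j * (n * a - j) ^ 2 = n * a * (1 - a) := by
  have := congrArg (Polynomial.eval a) (bernsteinPolynomial.variance ℝ n)
  simpa [Polynomial.eval_finsetSum, binomialWeight_eq_eval, mul_comm] using this

lemma sum_binomialWeight_mul_le {n : ℕ} {a t : ℝ} (ha : a ∈ Set.Icc (0 : ℝ) 1) (ht : 0 < t)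
    {g : ℕ → ℝ} (hg : ∀ j, g j ≤ (n * a - j) ^ 2 / (4 * t)) :
    ∑ j ∈ Finset.range (n + 1), binomialWeight n a j * g j ≤ n / (4 * t) := by
  have h1 : n * a * (1 - a) ≤ n := by
    have : a * (1 - a) ≤ 1 := by nlinarith [ha.1, ha.2]
    have hn : (0 : ℝ) ≤ n := Nat.cast_nonneg n
    nlinarith
  calc _ ≤ ∑ j ∈ Finset.range (n + 1), binomialWeight n a j * (n * a - j) ^ 2 / (4 * t) := by
        refine Finset.sum_le_sum fun j _ => ?_
        rw [mul_div_assoc]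
        exact mul_le_mul_of_nonneg_left (hg j) (binomialWeight_nonneg ha n j)
    _ = n * a * (1 - a) / (4 * t) := by rw [← Finset.sum_div, sum_binomialWeight_mul_sq]
    _ ≤ _ := by gcongr

lemma binomialExcess_nonneg {a : ℝ} (ha : a ∈ Set.Icc (0 : ℝ) 1) (n m : ℕ) :
    0 ≤ binomialExcess n m a :=
  Finset.sum_nonneg fun j _ => mul_nonneg (binomialWeight_nonneg ha n j) (Nat.cast_nonneg _)

/-- Above the mean, the expected excess is controlled by the variance. -/
lemma binomialExcess_le {n m : ℕ} {a : ℝ} (ha : a ∈ Set.Icc (0 : ℝ) 1) (h : n * a < m) :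
    binomialExcess n m a ≤ n / (4 * (m - n * a)) := by
  have ht : 0 < m - n * a := sub_pos.2 h
  refine sum_binomialWeight_mul_le ha ht fun j => ?_
  rw [le_div_iff₀ (by positivity)]
  rcases le_total j m with hj | hj
  · rw [Nat.sub_eq_zero_of_le hj, Nat.cast_zero, zero_mul]
    positivity
  · rw [Nat.cast_sub hj]
    nlinarith [sq_nonneg ((j : ℝ) - m - (m - n * a))]

/-- Below the mean, the expected excess is the distance to the mean, up to an error that is
controlled by the variance. -/
lemma abs_binomialExcess_sub_le {n m : ℕ} {a : ℝ} (ha : a ∈ Set.Icc (0 : ℝ) 1) (h : m < n * a) :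
    |binomialExcess n m a - (n * a - m)| ≤ n / (4 * (n * a - m)) := by
  have ht : 0 < n * a - m := sub_pos.2 h
  have hsplit : binomialExcess n m a - (n * a - m) =
      ∑ j ∈ Finset.range (n + 1), binomialWeight n a j * ((m - j : ℕ) : ℝ) := by
    have h1 := sum_binomialWeight n a
    have h2 := sum_binomialWeight_mul n a
    have h3 : n * a - m = ∑ j ∈ Finset.range (n + 1), binomialWeight n a j * (j - m) := by
      simp only [mul_sub, Finset.sum_sub_distrib, h2, ← Finset.sum_mul, h1, one_mul]
    rw [h3, binomialExcess, ← Finset.sum_sub_distrib]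
    refine Finset.sum_congr rfl fun j _ => ?_
    rw [← mul_sub]
    congr 1
    rcases le_total j m with hj | hj
    · rw [Nat.sub_eq_zero_of_le hj, Nat.cast_sub hj, Nat.cast_zero]
      ring
    · rw [Nat.sub_eq_zero_of_le hj, Nat.cast_sub hj, Nat.cast_zero]
      ring
  rw [hsplit, abs_of_nonneg (Finset.sum_nonneg fun j _ =>
    mul_nonneg (binomialWeight_nonneg ha n j) (Nat.cast_nonneg _))]
  refine sum_binomialWeight_mul_le ha ht fun j => ?_
  rw [le_div_iff₀ (by positivity)]
  rcases le_total m j with hj | hj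
  · rw [Nat.sub_eq_zero_of_le hj, Nat.cast_zero, zero_mul]
    positivity
  · rw [Nat.cast_sub hj]
    nlinarith [sq_nonneg ((m : ℝ) - j - (n * a - m))]

/-- De Moivre's summation of the mean deviation: `(j - n a) b(j)` is the difference of consecutive
values of `j (1 - a) b(j)`. -/
lemma sum_Ico_sub_mul_binomialWeight {n m : ℕ} (a : ℝ) (hm : m ≤ n) :
    ∑ j ∈ Finset.Ico m (n + 1), (j - n * a) * binomialWeight n a j =
      m * (1 - a) * binomialWeight n a m := by
  let T : ℕ → ℝ := fun j => j * (1 - a) * binomialWeight n a j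
  have hT : ∀ j ≤ n, (j - n * a) * binomialWeight n a j = T j - T (j + 1) := by
    intro j hj
    have hc : (n.choose (j + 1) : ℝ) * (j + 1) = n.choose j * (n - j) := by
      have := Nat.choose_succ_right_eq n j
      rw [← Nat.cast_sub hj]
      exact_mod_cast this
    have hpow : (n.choose j : ℝ) * (n - j) * ((1 - a) * (1 - a) ^ (n - (j + 1))) =
        n.choose j * (n - j) * (1 - a) ^ (n - j) := by
      rcases hj.eq_or_lt with rfl | hlt
      · simp
      · rw [← pow_succ', show n - (j + 1) + 1 = n - j by omega]
    simp only [T, binomialWeight]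
    push_cast
    have : ((j : ℝ) + 1) * (1 - a) * (n.choose (j + 1) * a ^ (j + 1) * (1 - a) ^ (n - (j + 1))) =
        a ^ (j + 1) * (n.choose j * (n - j) * (1 - a) ^ (n - j)) := by
      rw [← hpow, ← hc]
      ring
    rw [this, pow_succ]
    ring
  have htel : ∀ N, m ≤ N → ∑ j ∈ Finset.Ico m N, (T j - T (j + 1)) = T m - T N := by
    intro N hN
    induction N, hN using Nat.le_induction with
    | base => simp
    | succ N hN ih => rw [Finset.sum_Ico_succ_top hN, ih]; ring
  rw [Finset.sum_congr rfl fun j hj =>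
    hT j (Nat.lt_succ_iff.1 (Finset.mem_Ico.1 hj).2), htel _ (by omega)]
  simp [T, binomialWeight]

lemma abs_binomialExcess_sub_mul_binomialWeight_le {n m : ℕ} {a : ℝ}
    (ha : a ∈ Set.Icc (0 : ℝ) 1) (hm : m ≤ n) :
    |binomialExcess n m a - m * (1 - a) * binomialWeight n a m| ≤ |n * a - m| := by
  have h1 : binomialExcess n m a =
      ∑ j ∈ Finset.Ico m (n + 1), binomialWeight n a j * (j - m : ℝ) := by
    rw [binomialExcess, Finset.range_eq_Ico,
      ← Finset.sum_Ico_consecutive _ (Nat.zero_le m) (by omega : m ≤ n + 1)]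
    rw [Finset.sum_eq_zero, zero_add]
    · refine Finset.sum_congr rfl fun j hj => ?_
      rw [Nat.cast_sub (Finset.mem_Ico.1 hj).1]
    · intro j hj
      rw [Nat.sub_eq_zero_of_le (Finset.mem_Ico.1 hj).2.le, Nat.cast_zero, mul_zero]
  have h2 : binomialExcess n m a - m * (1 - a) * binomialWeight n a m =
      (n * a - m) * ∑ j ∈ Finset.Ico m (n + 1), binomialWeight n a j := by
    rw [h1, ← sum_Ico_sub_mul_binomialWeight a hm, ← Finset.sum_sub_distrib, Finset.mul_sum]
    exact Finset.sum_congr rfl fun j _ => by ring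
  have h3 : 0 ≤ ∑ j ∈ Finset.Ico m (n + 1), binomialWeight n a j :=
    Finset.sum_nonneg fun j _ => binomialWeight_nonneg ha n j
  have h4 : ∑ j ∈ Finset.Ico m (n + 1), binomialWeight n a j ≤ 1 := by
    rw [← sum_binomialWeight n a]
    refine Finset.sum_le_sum_of_subset_of_nonneg (fun j hj => ?_)
      fun j _ _ => binomialWeight_nonneg ha n j
    exact Finset.mem_range.2 (Finset.mem_Ico.1 hj).2
  rw [h2, abs_mul, abs_of_nonneg h3]
  exact mul_le_of_le_one_right (abs_nonneg _) h4

end Binomial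

/-! ### Stirling's formula for the binomial distribution near its mean -/

section Stirling

open Stirling in
lemma stirlingSeq_le_sqrt_pi_mul_exp {k : ℕ} (hk : k ≠ 0) :
    stirlingSeq k ≤ √Real.pi * Real.exp (1 / (2 * k)) := by
  obtain ⟨k, rfl⟩ := Nat.exists_eq_succ_of_ne_zero hk
  let f : ℕ → ℝ := fun i => Real.log (stirlingSeq (i + 1)) - 1 / (2 * ((i : ℝ) + 1))
  have hmono : Monotone f := by
    refine monotone_nat_of_le_succ fun i => ?_
    have h1 := log_stirlingSeq_sdiff_le (i + 1)
    have hi : (0 : ℝ) ≤ i := Nat.cast_nonneg i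
    have h2 : 1 / (12 * ((i : ℝ) + 1) * (i + 1 + 1)) ≤
        1 / (2 * ((i : ℝ) + 1)) - 1 / (2 * ((i : ℝ) + 1 + 1)) := by
      rw [div_sub_div _ _ (by positivity) (by positivity), div_le_div_iff₀ (by positivity)
        (by positivity)]
      nlinarith
    simp only [f]
    push_cast
    push_cast at h1
    linarith
  have hlim : Tendsto f atTop (nhds (Real.log √Real.pi - 0)) := by
    refine Tendsto.sub ?_ ?_
    · exact ((Real.continuousAt_log (by positivity)).tendsto.comp
        tendsto_stirlingSeq_sqrt_pi).comp (tendsto_add_atTop_nat 1)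
    · have := (tendsto_one_div_add_atTop_nhds_zero_nat (𝕜 := ℝ)).const_mul (1 / 2)
      rw [mul_zero] at this
      refine this.congr fun i => ?_
      rw [div_mul_div_comm, one_mul]
  have h := hmono.ge_of_tendsto hlim k
  rw [sub_zero] at h
  have hpos : 0 < stirlingSeq (k + 1) := stirlingSeq'_pos k
  calc stirlingSeq (k + 1) = Real.exp (Real.log (stirlingSeq (k + 1))) :=
        (Real.exp_log hpos).symm
    _ ≤ Real.exp (Real.log √Real.pi + 1 / (2 * ((k : ℝ) + 1))) :=
        Real.exp_le_exp.2 (by simp only [f] at h; linarith)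
    _ = _ := by
        rw [Real.exp_add, Real.exp_log (by positivity)]
        push_cast
        rfl

/-- The likelihood of `m` successes and `k` failures under the success probability `a`, relative to
the maximal likelihood. Minus its logarithm is a Kullback–Leibler divergence, which is nonnegative
and bounded above by the `χ²` divergence. -/
lemma likelihood_ratio_bounds {x y a : ℝ} {m k : ℕ} (hm : (m : ℝ) = x) (hk : (k : ℝ) = y)
    (hx : 0 < x) (hy : 0 < y) (ha0 : 0 < a) (ha1 : a < 1) :
    1 - (x - (x + y) * a) ^ 2 / ((x + y) * a * (1 - a)) ≤
      ((x + y) * a / x) ^ m * ((x + y) * (1 - a) / y) ^ k ∧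
    ((x + y) * a / x) ^ m * ((x + y) * (1 - a) / y) ^ k ≤ 1 := by
  have h1a : 0 < 1 - a := sub_pos.2 ha1
  have hu : 0 < (x + y) * a / x := by positivity
  have hv : 0 < (x + y) * (1 - a) / y := by positivity
  have hexp : ((x + y) * a / x) ^ m * ((x + y) * (1 - a) / y) ^ k =
      Real.exp (x * Real.log ((x + y) * a / x) + y * Real.log ((x + y) * (1 - a) / y)) := by
    rw [Real.exp_add, ← hm, ← hk, Real.exp_nat_mul, Real.exp_nat_mul, hm, hk, Real.exp_log hu,
      Real.exp_log hv]
  rw [hexp]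
  constructor
  · have h1 : 1 - ((x + y) * a / x)⁻¹ ≤ Real.log ((x + y) * a / x) :=
      Real.one_sub_inv_le_log_of_pos hu
    have h2 : 1 - ((x + y) * (1 - a) / y)⁻¹ ≤ Real.log ((x + y) * (1 - a) / y) :=
      Real.one_sub_inv_le_log_of_pos hv
    have h3 : -((x - (x + y) * a) ^ 2 / ((x + y) * a * (1 - a))) =
        x * (1 - ((x + y) * a / x)⁻¹) + y * (1 - ((x + y) * (1 - a) / y)⁻¹) := by
      field_simp
      ring
    have h4 := mul_le_mul_of_nonneg_left h1 hx.le
    have h5 := mul_le_mul_of_nonneg_left h2 hy.le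
    refine le_trans ?_ (Real.add_one_le_exp _)
    linarith
  · have h1 := Real.log_le_sub_one_of_pos hu
    have h2 := Real.log_le_sub_one_of_pos hv
    have h3 : x * ((x + y) * a / x - 1) + y * ((x + y) * (1 - a) / y - 1) = 0 := by
      field_simp
      ring
    have h4 := mul_le_mul_of_nonneg_left h1 hx.le
    have h5 := mul_le_mul_of_nonneg_left h2 hy.le
    rw [Real.exp_le_one_iff]
    linarith

open Stirling in
lemma factorial_eq_stirlingSeq_mul {k : ℕ} (hk : k ≠ 0) :
    (k.factorial : ℝ) = stirlingSeq k * (√(2 * k) * (k / Real.exp 1) ^ k) := by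
  have : 0 < √(2 * (k : ℝ)) * (k / Real.exp 1) ^ k := by positivity
  rw [stirlingSeq, div_mul_cancel₀ _ this.ne']

open Stirling in
/-- De Moivre–Laplace at a single point, with an explicit relative error. -/
lemma exists_mul_binomialWeight_eq {m k : ℕ} (hm : m ≠ 0) (hk : k ≠ 0) {a : ℝ} (ha0 : 0 < a)
    (ha1 : a < 1) :
    ∃ R : ℝ, m * (1 - a) * binomialWeight (m + k) a m =
        (1 - a) * √(m * (m + k) / k) * R / √(2 * Real.pi) ∧
      1 - (1 / (2 * m) + 1 / (2 * k)) - (m - (m + k) * a) ^ 2 / ((m + k) * a * (1 - a)) ≤ R ∧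
      R ≤ Real.exp (1 / (2 * (m + k))) := by
  have hm0 : (0 : ℝ) < m := by positivity
  have hk0 : (0 : ℝ) < k := by positivity
  have h1a : 0 < 1 - a := sub_pos.2 ha1
  have hmk : m + k ≠ 0 := by omega
  have hpi : 0 < √Real.pi := by positivity
  set Sm := stirlingSeq m with hSm
  set Sk := stirlingSeq k with hSk
  set Sn := stirlingSeq (m + k) with hSn
  have hSm1 : √Real.pi ≤ Sm := sqrt_pi_le_stirlingSeq hm
  have hSk1 : √Real.pi ≤ Sk := sqrt_pi_le_stirlingSeq hk
  have hSn1 : √Real.pi ≤ Sn := sqrt_pi_le_stirlingSeq hmk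
  have hSm0 : 0 < Sm := hpi.trans_le hSm1
  have hSk0 : 0 < Sk := hpi.trans_le hSk1
  have hSn0 : 0 < Sn := hpi.trans_le hSn1
  have hSm2 : Sm ≤ √Real.pi * Real.exp (1 / (2 * m)) := stirlingSeq_le_sqrt_pi_mul_exp hm
  have hSk2 : Sk ≤ √Real.pi * Real.exp (1 / (2 * k)) := stirlingSeq_le_sqrt_pi_mul_exp hk
  have hSn2 : Sn ≤ √Real.pi * Real.exp (1 / (2 * (m + k))) := by
    have := stirlingSeq_le_sqrt_pi_mul_exp hmk
    push_cast at this
    exact this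
  set R₁ := √Real.pi * Sn / (Sm * Sk) with hR1
  set R₂ := ((m + k : ℝ) * a / m) ^ m * ((m + k : ℝ) * (1 - a) / k) ^ k with hR2
  obtain ⟨hR2l, hR2u⟩ := likelihood_ratio_bounds (m := m) (k := k) rfl rfl hm0 hk0 ha0 ha1
  rw [← hR2] at hR2l hR2u
  have hR10 : 0 < R₁ := by positivity
  have hR20 : 0 < R₂ := by positivity
  refine ⟨R₁ * R₂, ?_, ?_, ?_⟩
  · have hchoose : ((m + k).choose m : ℝ) =
        (m + k).factorial / (m.factorial * k.factorial) := by
      rw [Nat.cast_add_choose]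
    rw [binomialWeight, hchoose, factorial_eq_stirlingSeq_mul hm, factorial_eq_stirlingSeq_mul hk,
      factorial_eq_stirlingSeq_mul hmk, Nat.add_sub_cancel_left, hR1, hR2]
    push_cast
    have hs1 : √(2 * ((m : ℝ) + k)) = √2 * √((m : ℝ) + k) := Real.sqrt_mul (by norm_num) _
    have hs2 : √(2 * (m : ℝ)) = √2 * √(m : ℝ) := Real.sqrt_mul (by norm_num) _
    have hs3 : √(2 * (k : ℝ)) = √2 * √(k : ℝ) := Real.sqrt_mul (by norm_num) _
    have hs4 : √(2 * Real.pi) = √2 * √Real.pi := Real.sqrt_mul (by norm_num) _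
    have hs5 : √((m : ℝ) * (m + k) / k) = √(m : ℝ) * √((m : ℝ) + k) / √(k : ℝ) := by
      rw [Real.sqrt_div (by positivity), Real.sqrt_mul hm0.le]
    have hsm : (m : ℝ) = √(m : ℝ) * √(m : ℝ) := (Real.mul_self_sqrt hm0.le).symm
    have hsm0 : 0 < √(m : ℝ) := Real.sqrt_pos.2 hm0
    have hsk0 : 0 < √(k : ℝ) := Real.sqrt_pos.2 hk0
    rw [hs1, hs2, hs3, hs4, hs5]
    set sm := √(m : ℝ)
    set sk := √(k : ℝ)
    set sn := √((m : ℝ) + k)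
    set e := Real.exp 1 with he
    have he0 : 0 < e := Real.exp_pos 1
    have hpow : ((m : ℝ) + k) ^ (m + k) = ((m : ℝ) + k) ^ m * ((m : ℝ) + k) ^ k := pow_add _ _ _
    have hpowe : e ^ (m + k) = e ^ m * e ^ k := pow_add _ _ _
    simp only [div_pow, mul_pow, hpow, hpowe]
    rw [← hSm, ← hSk, ← hSn]
    set Mm := (m : ℝ) ^ m
    have hMm : 0 < Mm := by positivity
    set Kk := (k : ℝ) ^ k
    have hKk : 0 < Kk := by positivity
    set N1 := ((m : ℝ) + k) ^ m
    set N2 := ((m : ℝ) + k) ^ k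
    have h2 : (0 : ℝ) < √2 := by positivity
    have hmm : (m : ℝ) / sm = sm := by rw [div_eq_iff hsm0.ne']; exact hsm
    generalize hmr : (m : ℝ) = mr at *
    have : mr = sm * sm := hsm
    rw [this]
    field_simp
  · have hR1l : 1 - (1 / (2 * m) + 1 / (2 * k)) ≤ R₁ := by
      have h1 : Real.exp (-(1 / (2 * m) + 1 / (2 * k))) ≤ R₁ := by
        rw [hR1, le_div_iff₀ (by positivity)]
        calc Real.exp (-(1 / (2 * (m : ℝ)) + 1 / (2 * k))) * (Sm * Sk) ≤
            Real.exp (-(1 / (2 * (m : ℝ)) + 1 / (2 * k))) *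
              ((√Real.pi * Real.exp (1 / (2 * m))) * (√Real.pi * Real.exp (1 / (2 * k)))) := by
              gcongr
          _ = √Real.pi * √Real.pi := by
              rw [Real.exp_neg, Real.exp_add]
              field_simp
          _ ≤ _ := by gcongr
      have h2 := Real.add_one_le_exp (-(1 / (2 * (m : ℝ)) + 1 / (2 * k)))
      linarith
    set x₁ : ℝ := 1 / (2 * m) + 1 / (2 * k)
    set x₂ : ℝ := (m - (m + k) * a) ^ 2 / ((m + k) * a * (1 - a))
    have hx1 : 0 ≤ x₁ := by positivity
    have hx2 : 0 ≤ x₂ := by positivity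
    calc 1 - x₁ - x₂ ≤ R₂ - x₁ := by linarith
      _ ≤ R₂ - x₁ * R₂ := by
          have := mul_le_of_le_one_right hx1 hR2u
          linarith
      _ = (1 - x₁) * R₂ := by ring
      _ ≤ R₁ * R₂ := by gcongr
  · have hR1u : R₁ ≤ Real.exp (1 / (2 * (m + k))) := by
      rw [hR1, div_le_iff₀ (by positivity)]
      calc √Real.pi * Sn ≤ √Real.pi * (√Real.pi * Real.exp (1 / (2 * (m + k)))) := by gcongr
        _ = Real.exp (1 / (2 * (m + k))) * (√Real.pi * √Real.pi) := by ring
        _ ≤ _ := by gcongr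
    calc R₁ * R₂ ≤ R₁ * 1 := by gcongr
      _ ≤ _ := by rw [mul_one]; exact hR1u

end Stirling

/-! ### Asymptotics -/

section Asymptotics

lemma exists_pow_mul_pow_le (k : ℕ) {θ A : ℝ} (hθ : θ ∈ Set.Ico (0 : ℝ) 1) (hA : 0 ≤ A) :
    ∃ D : ℝ, 0 ≤ D ∧ ∀ n j : ℕ, (n : ℝ) ≤ A * (j + 1) → (n : ℝ) ^ k * θ ^ j ≤ D := by
  -- a positive upper bound for `θ` allows a shift of the exponent
  set η := max θ (1 / 2) with hη
  have hη0 : 0 < η := lt_max_of_lt_right (by norm_num)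
  have hη1 : η < 1 := max_lt hθ.2 (by norm_num)
  have hlim := tendsto_pow_const_mul_const_pow_of_abs_lt_one k
    (r := η) (by rwa [abs_of_pos hη0])
  obtain ⟨M, hM⟩ := hlim.bddAbove_range
  have hM' : ∀ j : ℕ, (j : ℝ) ^ k * η ^ j ≤ M := fun j => hM ⟨j, rfl⟩
  have hM0 : 0 ≤ M := le_trans (by positivity) (hM' 0)
  refine ⟨A ^ k * (M / η), by positivity, fun n j h => ?_⟩
  have h1 : ((j : ℝ) + 1) ^ k * η ^ j ≤ M / η := by
    rw [le_div_iff₀ hη0, mul_assoc, ← pow_succ]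
    exact_mod_cast hM' (j + 1)
  have h2 : θ ^ j ≤ η ^ j := pow_le_pow_left₀ hθ.1 (le_max_left _ _) j
  calc (n : ℝ) ^ k * θ ^ j ≤ (A * (j + 1)) ^ k * η ^ j :=
        mul_le_mul (pow_le_pow_left₀ (Nat.cast_nonneg n) h k) h2 (pow_nonneg hθ.1 _)
          (by positivity)
    _ = A ^ k * (((j : ℝ) + 1) ^ k * η ^ j) := by rw [mul_pow]; ring
    _ ≤ _ := by gcongr

/-- The leading term of the local limit theorem depends on the parameters in a stable way. -/
lemma abs_mul_sqrt_sub_sqrt_le {μ a D x y : ℝ} (hμ : μ ∈ Set.Ioo (0 : ℝ) 1)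
    (hx : 0 < x) (hy : 0 < y) (hxμ : x ≤ μ * (x + y)) (hxμ' : μ * (x + y) < x + 1)
    (h1 : 1 ≤ x + y) (ha : a ∈ Set.Ioo (0 : ℝ) 1) (haμ : (x + y) * |a - μ| ≤ D) :
    |(1 - a) * √(x * (x + y) / y) - √(μ * (1 - μ) * (x + y))| ≤
      (2 * D + 2) / (1 - μ) / √(μ * (1 - μ)) := by
  have hμ0 : 0 < μ := hμ.1
  have h1μ : 0 < 1 - μ := sub_pos.2 hμ.2
  have h1a : 0 < 1 - a := sub_pos.2 ha.2
  have ha0 := ha.1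
  have hs : 0 < μ * (1 - μ) := mul_pos hμ0 h1μ
  have hxy : 0 < x + y := by linarith
  set U := (1 - a) * √(x * (x + y) / y) with hU
  set V := √(μ * (1 - μ) * (x + y)) with hV
  have hU0 : 0 ≤ U := by positivity
  have hV0 : 0 < V := Real.sqrt_pos.2 (by positivity)
  have hU2 : U ^ 2 = (1 - a) ^ 2 * (x * (x + y) / y) := by
    rw [hU, mul_pow, Real.sq_sqrt (by positivity)]
  have hV2 : V ^ 2 = μ * (1 - μ) * (x + y) := Real.sq_sqrt (by positivity)
  have hdiff : U ^ 2 - V ^ 2 = ((x + y) / y) * (μ * ((x + y) * ((μ - a) * (2 - a - μ))) -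
      (μ * (x + y) - x) * ((1 - a) ^ 2 + μ * (1 - μ))) := by
    rw [hU2, hV2]
    field_simp
    ring
  have h2 : |μ * ((x + y) * ((μ - a) * (2 - a - μ)))| ≤ 2 * D := by
    have h3 : μ * ((x + y) * ((μ - a) * (2 - a - μ))) =
        (μ * (2 - a - μ)) * ((x + y) * (μ - a)) := by ring
    have h4 : 0 ≤ μ * (2 - a - μ) := mul_nonneg hμ0.le (by linarith)
    have h5 : μ * (2 - a - μ) ≤ 2 := by nlinarith [mul_pos hμ0 ha0]
    rw [h3, abs_mul, abs_of_nonneg h4, abs_mul, abs_of_pos hxy, abs_sub_comm]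
    exact mul_le_mul h5 haμ (by positivity) (by norm_num)
  have h3 : |(μ * (x + y) - x) * ((1 - a) ^ 2 + μ * (1 - μ))| ≤ 2 := by
    have h4 : 0 ≤ (1 - a) ^ 2 + μ * (1 - μ) := by positivity
    have h5 : (1 - a) ^ 2 + μ * (1 - μ) ≤ 2 := by nlinarith
    rw [abs_mul, abs_of_nonneg (by linarith : 0 ≤ μ * (x + y) - x), abs_of_nonneg h4]
    calc _ ≤ 1 * 2 := mul_le_mul (by linarith) h5 h4 zero_le_one
      _ = 2 := by norm_num
  have h4 : (x + y) / y ≤ 1 / (1 - μ) := by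
    rw [div_le_div_iff₀ hy h1μ]
    linarith
  have h5 : |U ^ 2 - V ^ 2| ≤ (2 * D + 2) / (1 - μ) := by
    rw [hdiff, abs_mul, abs_of_pos (by positivity)]
    calc _ ≤ 1 / (1 - μ) * (2 * D + 2) :=
          mul_le_mul h4 ((abs_sub _ _).trans (add_le_add h2 h3)) (abs_nonneg _) (by positivity)
      _ = _ := by ring
  have h6 : √(μ * (1 - μ)) ≤ U + V := by
    have : √(μ * (1 - μ)) ≤ V := Real.sqrt_le_sqrt (le_mul_of_one_le_right hs.le h1)
    linarith
  have h7 : |U - V| * (U + V) = |U ^ 2 - V ^ 2| := by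
    rw [sq_sub_sq, abs_mul, abs_of_pos (by linarith : 0 < U + V), mul_comm]
  rw [le_div_iff₀ (Real.sqrt_pos.2 hs)]
  calc |U - V| * √(μ * (1 - μ)) ≤ |U - V| * (U + V) :=
        mul_le_mul_of_nonneg_left h6 (abs_nonneg _)
    _ ≤ _ := by rw [h7]; exact h5

/-- At the critical threshold, the expected excess of a binomial random variable is half of its mean
absolute deviation, up to a bounded error. -/
lemma exists_abs_binomialExcess_sub_sqrt_le {μ D : ℝ} (hμ : μ ∈ Set.Ioo (0 : ℝ) 1) (hD : 0 ≤ D) :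
    ∃ C : ℝ, ∀ᶠ n : ℕ in atTop, ∀ (m : ℕ) (a : ℝ), (m : ℝ) ≤ μ * n → μ * n < m + 1 →
      n * |a - μ| ≤ D → |binomialExcess n m a - √(μ * (1 - μ) * n / (2 * Real.pi))| ≤ C := by
  have hμ0 : 0 < μ := hμ.1
  have h1μ : 0 < 1 - μ := sub_pos.2 hμ.2
  have hs : 0 < μ * (1 - μ) := mul_pos hμ0 h1μ
  -- the constants in the relative and the absolute error of the local limit theorem
  set D₁ : ℝ := 1 + (1 / μ + 1 / (2 * (1 - μ))) + (D + 1) ^ 2 * 4 / (μ * (1 - μ)) with hD1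
  have hD10 : 0 ≤ D₁ := by positivity
  set D₂ : ℝ := (2 * D + 2) / (1 - μ) / √(μ * (1 - μ)) with hD2
  have hD20 : 0 ≤ D₂ := by positivity
  refine ⟨(D + 1) + (D₁ * √(1 / (1 - μ)) + D₂), ?_⟩
  have hev : ∀ c : ℝ, ∀ᶠ n : ℕ in atTop, c ≤ n := fun c =>
    (tendsto_natCast_atTop_atTop (R := ℝ)).eventually_ge_atTop c
  filter_upwards [hev 1, hev (2 / μ), hev (2 * D / μ), hev (2 * D / (1 - μ))] with
    n hn1 hn2 hn3 hn4 m a hm hm' ha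
  have hn0 : (0 : ℝ) < n := by linarith
  rw [div_le_iff₀ hμ0] at hn2 hn3
  rw [div_le_iff₀ h1μ] at hn4
  have hmn : m < n := by
    have : (m : ℝ) < n := by nlinarith
    exact_mod_cast this
  obtain ⟨k, rfl⟩ : ∃ k, n = m + k := ⟨n - m, by omega⟩
  have hk0 : k ≠ 0 := by omega
  have hmpos : μ * (m + k : ℕ) / 2 ≤ m := by linarith
  have hm0 : m ≠ 0 := by
    rintro rfl
    rw [Nat.cast_zero] at hmpos
    have : 0 < μ * (0 + k : ℕ) := mul_pos hμ0 hn0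
    linarith
  push_cast at *
  set N : ℝ := m + k with hN
  have hk : (1 - μ) * N ≤ k := by
    have : (k : ℝ) = N - m := by rw [hN]; ring
    rw [this]
    linarith
  have hkpos : (0 : ℝ) < k := lt_of_lt_of_le (mul_pos h1μ hn0) hk
  have hmpos' : (0 : ℝ) < m := by positivity
  have haμ : |a - μ| ≤ μ / 2 := by
    refine le_of_mul_le_mul_left (ha.trans ?_) hn0
    linarith
  have haμ' : |a - μ| ≤ (1 - μ) / 2 := by
    refine le_of_mul_le_mul_left (ha.trans ?_) hn0
    linarith
  rw [abs_le] at haμ haμ'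
  have ha0 : 0 < a := by linarith [haμ.1]
  have ha1 : a < 1 := by linarith [haμ'.2]
  have h1a : 0 < 1 - a := sub_pos.2 ha1
  have hdev : |N * a - m| ≤ D + 1 := by
    have h1 : N * a - m = N * (a - μ) + (μ * N - m) := by ring
    rw [h1]
    refine (abs_add_le _ _).trans (add_le_add ?_ ?_)
    · rwa [abs_mul, abs_of_pos hn0]
    · rw [abs_le]
      constructor <;> linarith
  have hexc := abs_binomialExcess_sub_mul_binomialWeight_le (n := m + k) (m := m)
    ⟨ha0.le, ha1.le⟩ (Nat.le_add_right m k)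
  push_cast at hexc
  rw [← hN] at hexc
  obtain ⟨R, hR, hRl, hRu⟩ := exists_mul_binomialWeight_eq hm0 hk0 ha0 ha1
  rw [hR] at hexc
  rw [← hN] at hexc hRl hRu
  set U := (1 - a) * √(m * N / k) with hU
  set V := √(μ * (1 - μ) * N) with hV
  have hV0 : 0 < V := Real.sqrt_pos.2 (by positivity)
  have hU0 : 0 ≤ U := by positivity
  have hR1 : |R - 1| ≤ D₁ / N := by
    rw [abs_le]
    constructor
    · have h1 : 1 / (2 * (m : ℝ)) ≤ 1 / μ / N := by
        rw [div_div]
        exact one_div_le_one_div_of_le (by positivity) (by linarith)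
      have h2 : 1 / (2 * (k : ℝ)) ≤ 1 / (2 * (1 - μ)) / N := by
        rw [div_div]
        exact one_div_le_one_div_of_le (by positivity) (by linarith)
      have h3 : (m - N * a) ^ 2 / (N * a * (1 - a)) ≤ (D + 1) ^ 2 * 4 / (μ * (1 - μ)) / N := by
        rw [div_div]
        have h4 : (m - N * a) ^ 2 ≤ (D + 1) ^ 2 := by
          rw [← sq_abs, abs_sub_comm]
          exact pow_le_pow_left₀ (abs_nonneg _) hdev 2
        have h5 : μ / 2 * ((1 - μ) / 2) ≤ a * (1 - a) := by
          apply mul_le_mul <;> linarith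
        rw [div_le_div_iff₀ (by positivity) (by positivity)]
        calc (m - N * a) ^ 2 * (μ * (1 - μ) * N) ≤ (D + 1) ^ 2 * (μ * (1 - μ) * N) := by gcongr
          _ = (D + 1) ^ 2 * 4 * (N * (μ / 2 * ((1 - μ) / 2))) := by ring
          _ ≤ (D + 1) ^ 2 * 4 * (N * (a * (1 - a))) := by gcongr
          _ = _ := by ring
      have h6 : 0 ≤ 1 / N := by positivity
      rw [hD1, add_div, add_div, add_div]
      linarith
    · have h1 : |Real.exp (1 / (2 * N)) - 1| ≤ 2 * |1 / (2 * N)| := by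
        refine Real.abs_exp_sub_one_le ?_
        rw [abs_of_pos (by positivity), div_le_one (by positivity)]
        linarith
      rw [abs_of_pos (show 0 < 1 / (2 * N) by positivity)] at h1
      have h2 : 2 * (1 / (2 * N)) = 1 / N := by field_simp
      have h3 := le_abs_self (Real.exp (1 / (2 * N)) - 1)
      have h4 : 1 / N ≤ D₁ / N := by
        gcongr
        have : 0 ≤ 1 / μ + 1 / (2 * (1 - μ)) := by positivity
        have : 0 ≤ (D + 1) ^ 2 * 4 / (μ * (1 - μ)) := by positivity
        linarith
      linarith
  have hUle : U ≤ √(1 / (1 - μ)) * N := by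
    have h1 : (m : ℝ) * N / k ≤ 1 / (1 - μ) * N := by
      rw [div_mul_eq_mul_div, div_le_div_iff₀ hkpos h1μ, one_mul]
      have : (m : ℝ) ≤ N := by rw [hN]; linarith
      calc (m : ℝ) * N * (1 - μ) = m * ((1 - μ) * N) := by ring
        _ ≤ m * k := by gcongr
        _ ≤ N * k := by gcongr
    calc U ≤ 1 * √(m * N / k) := by
          rw [hU]
          gcongr
          linarith
      _ ≤ √(1 / (1 - μ) * N) := by rw [one_mul]; exact Real.sqrt_le_sqrt h1
      _ = √(1 / (1 - μ)) * √N := Real.sqrt_mul (by positivity) _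
      _ ≤ √(1 / (1 - μ)) * N := by
          gcongr
          rw [Real.sqrt_le_left (by positivity)]
          nlinarith
  have hUV : |U - V| ≤ D₂ :=
    abs_mul_sqrt_sub_sqrt_le hμ hmpos' hkpos hm hm' hn1 ⟨ha0, ha1⟩ ha
  have hURV : |U * R - V| ≤ D₁ * √(1 / (1 - μ)) + D₂ := by
    have h1 : U * R - V = U * (R - 1) + (U - V) := by ring
    rw [h1]
    refine (abs_add_le _ _).trans (add_le_add ?_ hUV)
    rw [abs_mul, abs_of_nonneg hU0]
    calc U * |R - 1| ≤ (√(1 / (1 - μ)) * N) * (D₁ / N) := by gcongr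
      _ = _ := by field_simp
  have hsq : √(μ * (1 - μ) * N / (2 * Real.pi)) = V / √(2 * Real.pi) :=
    Real.sqrt_div (by positivity) _
  have h2pi : 1 ≤ √(2 * Real.pi) := by
    rw [Real.one_le_sqrt]
    linarith [Real.pi_gt_three]
  have hmain : |U * R / √(2 * Real.pi) - V / √(2 * Real.pi)| ≤ D₁ * √(1 / (1 - μ)) + D₂ := by
    rw [← sub_div, abs_div, abs_of_pos (by linarith : 0 < √(2 * Real.pi))]
    exact (div_le_self (abs_nonneg _) h2pi).trans hURV
  rw [hsq]
  calc _ ≤ |binomialExcess (m + k) m a - U * R / √(2 * Real.pi)| +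
        |U * R / √(2 * Real.pi) - V / √(2 * Real.pi)| := abs_sub_le _ _ _
    _ ≤ _ := add_le_add (hexc.trans hdev) hmain

open Classical in
/-- The expected `p`-rank agrees, up to a bounded error, with the expected excess over the size of
the right side of a binomial random variable, which counts the vertices on the left with degree
divisible by `p`. -/
lemma exists_abs_expectedPRank_sub_binomialExcess_le {α q : ℝ} (hα : α ∈ Set.Ioo (0 : ℝ) 1)
    (hq : q ∈ Set.Ioo (0 : ℝ) 1) (p : ℕ) [Fact p.Prime] :
    ∃ (C D : ℝ) (a : ℕ → ℝ), 0 ≤ D ∧ (∀ n, a n ∈ Set.Icc (0 : ℝ) 1) ∧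
      (∀ n : ℕ, n * |a n - 1 / p| ≤ D) ∧
      ∀ᶠ n : ℕ in atTop, |expectedPRank p n α ⟨q, Set.Ioo_subset_Icc_self hq⟩ -
        binomialExcess n ⌊α * n⌋₊ (a n)| ≤ C := by
  have hqI : q ∈ Set.Icc (0 : ℝ) 1 := Set.Ioo_subset_Icc_self hq
  obtain ⟨θ, hθ0, hθ1, hθ⟩ := exists_abs_bitSumLaw_sub_le (p := p) hq
  obtain ⟨ρ, hρ0, hρ1, K, hK⟩ := exists_bitWeight_mul_bitSumLaw_le (p := p) hq
  have hα0 := hα.1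
  have h1α : 0 < 1 - α := sub_pos.2 hα.2
  have hmle : ∀ n : ℕ, (⌊α * n⌋₊ : ℝ) ≤ α * n := fun n =>
    Nat.floor_le (by positivity)
  have hmn : ∀ n : ℕ, ⌊α * n⌋₊ ≤ n := fun n => by
    have h1 := hmle n
    have h2 : α * n ≤ 1 * n := by gcongr; exact hα.2.le
    have : (⌊α * n⌋₊ : ℝ) ≤ n := by linarith
    exact_mod_cast this
  have hm : ∀ n : ℕ, (n : ℝ) ≤ 1 / α * (⌊α * n⌋₊ + 1) := fun n => by
    have := (Nat.lt_floor_add_one (α * n)).le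
    rw [one_div, ← div_eq_inv_mul, le_div_iff₀ hα0]
    linarith
  have hnm : ∀ n : ℕ, (n : ℝ) ≤ 1 / (1 - α) * ((n - ⌊α * n⌋₊ : ℕ) + 1) := fun n => by
    rw [one_div, ← div_eq_inv_mul, le_div_iff₀ h1α, Nat.cast_sub (hmn n)]
    linarith [hmle n]
  have hnn : ∀ n : ℕ, (n : ℝ) ≤ 1 * (n + 1) := fun n => by linarith
  obtain ⟨D, hD0, hD⟩ := exists_pow_mul_pow_le 1 ⟨hθ0, hθ1⟩ (by positivity : 0 ≤ 1 / α)
  obtain ⟨D₁, -, hD₁⟩ := exists_pow_mul_pow_le 2 ⟨hρ0.le, hρ1⟩ (by positivity : 0 ≤ 1 / (1 - α))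
  obtain ⟨D₂, -, hD₂⟩ := exists_pow_mul_pow_le 3 (θ := 1 - q ^ 2)
    ⟨by nlinarith [hq.1, hq.2], by nlinarith [hq.1]⟩ (by positivity : 0 ≤ 1 / α)
  obtain ⟨D₃, -, hD₃⟩ := exists_pow_mul_pow_le 2 (θ := 1 - q)
    ⟨by linarith [hq.2], by linarith [hq.1]⟩ (zero_le_one (α := ℝ))
  have hC0 : 0 ≤ (1 + ρ⁻¹ / (1 - ρ)) / (ρ⁻¹ - 1) := by
    have h1 : 0 < ρ⁻¹ - 1 := sub_pos.2 ((one_lt_inv₀ hρ0).2 hρ1)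
    have h2 : 0 < 1 - ρ := sub_pos.2 hρ1
    positivity
  refine ⟨(1 + (2 * D₂ + 2 * D₃)) + ((1 + ρ⁻¹ / (1 - ρ)) / (ρ⁻¹ - 1) + 2 * K + 2 * D₁), D,
    fun n => bitSumLaw (ZMod p) q ⌊α * n⌋₊ 0, hD0, fun n => ?_, fun n => ?_, ?_⟩
  · refine ⟨bitSumLaw_nonneg hqI _ _, ?_⟩
    rw [← sum_bitSumLaw (F := ZMod p) q ⌊α * n⌋₊]
    exact Finset.single_le_sum (fun f _ => bitSumLaw_nonneg hqI _ f) (Finset.mem_univ 0)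
  · refine le_trans ?_ (hD n _ (hm n))
    rw [pow_one]
    exact mul_le_mul_of_nonneg_left (hθ _ _) (Nat.cast_nonneg n)
  · have hlarge : ∀ᶠ n : ℕ in atTop, K ≤ ⌊α * n⌋₊ :=
      (tendsto_nat_floor_atTop.comp ((tendsto_natCast_atTop_atTop (R := ℝ)).const_mul_atTop
        hα0)).eventually_ge_atTop K
    filter_upwards [hlarge, eventually_gt_atTop 0] with n hKn hn
    have hD₁' := hD₁ n _ (hnm n)
    have hD₂' := hD₂ n _ (hm n)
    have hD₃' := hD₃ n _ (hnn n)
    have hmn' := hmn n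
    rw [expectedPRank_eq_sum]
    set m := ⌊α * n⌋₊ with hmdef
    have h1 := abs_sum_pRank_sub_sum_corank_le (p := p) (m := m) hqI hn
    have h2 := sum_bipartiteCorank_bounds (F := ZMod p) hqI hρ0 hρ1 hK n m hKn hmn'
    rw [sum_bitSumLaw, one_pow, mul_one, sum_prod_mul_card_zeros (sum_bitSumLaw (F := ZMod p) q m) n
      (fun j => ((j - m : ℕ) : ℝ))] at h2
    change binomialExcess n m _ ≤ ∑ B : Fin m → Fin n → Bool, columnsWeight q B * _ ∧
      ∑ B : Fin m → Fin n → Bool, columnsWeight q B * _ ≤ binomialExcess n m _ + _ at h2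
    have h3 : ((n : ℝ) + m) * (n ^ 2 * (1 - q ^ 2) ^ m + m * (1 - q) ^ n) ≤ 2 * D₂ + 2 * D₃ := by
      have hmr : (m : ℝ) ≤ n := by exact_mod_cast hmn'
      have e1 : 0 ≤ (1 - q ^ 2) ^ m := pow_nonneg (by nlinarith [hq.1, hq.2]) _
      have e2 : 0 ≤ (1 - q) ^ n := pow_nonneg (by linarith [hq.2]) _
      calc _ ≤ ((n : ℝ) + n) * (n ^ 2 * (1 - q ^ 2) ^ m + n * (1 - q) ^ n) := by gcongr
        _ = 2 * (n ^ 3 * (1 - q ^ 2) ^ m) + 2 * (n ^ 2 * (1 - q) ^ n) := by ring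
        _ ≤ _ := by gcongr
    have h4 : 2 * (n : ℝ) * (n * ρ ^ (n - m)) ≤ 2 * D₁ := by
      calc _ = 2 * ((n : ℝ) ^ 2 * ρ ^ (n - m)) := by ring
        _ ≤ _ := by gcongr
    refine (abs_sub_le _ _ _).trans (add_le_add (h1.trans ?_) ?_)
    · linarith
    · rw [abs_of_nonneg (sub_nonneg.2 h2.1)]
      have h5 := h2.2
      refine (sub_le_iff_le_add'.2 h5).trans ?_
      linarith

lemma isBigO_one_of_eventually_abs_le {f : ℕ → ℝ} {C : ℝ} (h : ∀ᶠ n in atTop, |f n| ≤ C) :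
    f =O[atTop] fun _ => (1 : ℝ) :=
  IsBigO.of_bound C (h.mono fun n hn => by simpa using hn)

end Asymptotics

theorem mainTheorem1 (α q : ℝ) (hα : α ∈ Set.Ioo (0 : ℝ) 1) (hq : q ∈ Set.Ioo (0 : ℝ) 1)
    (p : ℕ) (hp : p.Prime) :
    (α < 1 / p →
      (fun n : ℕ => expectedPRank p n α ⟨q, Set.Ioo_subset_Icc_self hq⟩ - (1 / p - α) * n)
        =O[atTop] fun _ => (1 : ℝ)) ∧
    (1 / p < α →
      (fun n : ℕ => expectedPRank p n α ⟨q, Set.Ioo_subset_Icc_self hq⟩)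
        =O[atTop] fun _ => (1 : ℝ)) ∧
    (α = 1 / p →
      (fun n : ℕ => expectedPRank p n α ⟨q, Set.Ioo_subset_Icc_self hq⟩
          - √((1 / p) * (1 - 1 / p) * n / (2 * Real.pi)))
        =O[atTop] fun _ => (1 : ℝ)) := by
  have : Fact p.Prime := ⟨hp⟩
  obtain ⟨C, D, a, hD, ha, haD, hC⟩ := exists_abs_expectedPRank_sub_binomialExcess_le hα hq p
  have hmle : ∀ n : ℕ, (⌊α * n⌋₊ : ℝ) ≤ α * n := fun n =>
    Nat.floor_le (mul_nonneg hα.1.le (Nat.cast_nonneg n))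
  have hmlt : ∀ n : ℕ, α * n < ⌊α * n⌋₊ + 1 := fun n => Nat.lt_floor_add_one _
  have hna : ∀ n : ℕ, |n * a n - 1 / p * n| ≤ D := fun n => by
    have h : n * a n - 1 / p * n = n * (a n - 1 / p) := by ring
    rw [h, abs_mul, Nat.abs_cast]
    exact haD n
  have hev : ∀ c : ℝ, ∀ᶠ n : ℕ in atTop, c ≤ n := fun c =>
    (tendsto_natCast_atTop_atTop (R := ℝ)).eventually_ge_atTop c
  refine ⟨fun h => ?_, fun h => ?_, fun h => ?_⟩
  · set ε := 1 / (p : ℝ) - α with hε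
    have hε0 : 0 < ε := sub_pos.2 h
    refine isBigO_one_of_eventually_abs_le (C := C + (1 / (2 * ε) + (D + 1))) ?_
    filter_upwards [hC, hev (2 * D / ε), hev 1] with n hn hn2 hn1
    rw [div_le_iff₀ hε0] at hn2
    have h1 := abs_le.1 (hna n)
    have h2 : ε * n / 2 ≤ n * a n - ⌊α * n⌋₊ := by
      have := hmle n
      rw [hε] at hn2 ⊢
      linarith [h1.1]
    have hpos : 0 < ε * n / 2 := by positivity
    have h3 := abs_binomialExcess_sub_le (ha n) (by linarith : (⌊α * n⌋₊ : ℝ) < n * a n)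
    have h4 : (n : ℝ) / (4 * (n * a n - ⌊α * n⌋₊)) ≤ 1 / (2 * ε) := by
      rw [div_le_div_iff₀ (by linarith) (by positivity)]
      linarith
    have h5 : |n * a n - ⌊α * n⌋₊ - ε * n| ≤ D + 1 := by
      have := hmle n
      have := hmlt n
      rw [abs_le, hε]
      constructor <;> linarith [h1.1, h1.2]
    calc _ ≤ _ := abs_sub_le _ (binomialExcess n ⌊α * n⌋₊ (a n)) _
      _ ≤ C + (|binomialExcess n ⌊α * n⌋₊ (a n) - (n * a n - ⌊α * n⌋₊)| +
          |n * a n - ⌊α * n⌋₊ - ε * n|) := add_le_add hn (abs_sub_le _ _ _)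
      _ ≤ _ := by gcongr; exact h3.trans h4
  · set ε := α - 1 / (p : ℝ) with hε
    have hε0 : 0 < ε := sub_pos.2 h
    refine isBigO_one_of_eventually_abs_le (C := C + 1 / (2 * ε)) ?_
    filter_upwards [hC, hev (2 * (D + 1) / ε), hev 1] with n hn hn2 hn1
    rw [div_le_iff₀ hε0] at hn2
    have h1 := abs_le.1 (hna n)
    have h2 : ε * n / 2 ≤ ⌊α * n⌋₊ - n * a n := by
      have := hmlt n
      rw [hε] at hn2 ⊢
      linarith [h1.2]
    have hpos : 0 < ε * n / 2 := by positivity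
    have h3 := binomialExcess_le (ha n) (by linarith : n * a n < (⌊α * n⌋₊ : ℝ))
    have h4 : (n : ℝ) / (4 * (⌊α * n⌋₊ - n * a n)) ≤ 1 / (2 * ε) := by
      rw [div_le_div_iff₀ (by linarith) (by positivity)]
      linarith
    have h5 := binomialExcess_nonneg (ha n) n ⌊α * n⌋₊
    calc _ = |(expectedPRank p n α ⟨q, Set.Ioo_subset_Icc_self hq⟩ -
          binomialExcess n ⌊α * n⌋₊ (a n)) + binomialExcess n ⌊α * n⌋₊ (a n)| := by
          rw [sub_add_cancel]
      _ ≤ _ := abs_add_le _ _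
      _ ≤ _ := by
          rw [abs_of_nonneg h5]
          exact add_le_add hn (h3.trans h4)
  · rw [← h] at haD ⊢
    obtain ⟨C', hC'⟩ := exists_abs_binomialExcess_sub_sqrt_le hα hD
    refine isBigO_one_of_eventually_abs_le (C := C + C') ?_
    filter_upwards [hC, hC'] with n hn hn'
    exact (abs_sub_le _ _ _).trans
      (add_le_add hn (hn' ⌊α * n⌋₊ (a n) (hmle n) (hmlt n) (haD n)))
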